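/- Let $p$ be a prime, $K$ a field of characteristic $p$, and $L$ a Lie $p$-algebra (restricted Lie algebra) over $K$, of arbitrary dimension, with $p$-map $x \mapsto x^{[p]}$. Let $u(L)$ be its restricted universal enveloping algebra, and let the restricted cohomological dimension $\mathrm{cd}_*(L)$ be the projective dimension of the trivial right $u(L)$-module $K$. A $p$-subalgebra is a Lie subalgebra closed under the $p$-map. A torus is an abelian Lie $p$-algebra in which every element $x$ is a linear combination of its $p$-powers $x^{[p]^k}$, $k = 1, 2, \dots$. An element $x \in L$ is called $p$-algebraic if $x, x^{[p]}, x^{[p]^2}, \dots$ are linearly dependent over $K$, and $p$-semisimple if it is a linear combination of the elements $x^{[p]^k}$, $k = 1, 2, \dots$. Suppose that $\mathrm{cd}_*(L) < \infty$. Then every $p$-subalgebra of $L$ is a torus or is infinite-dimensional. In particular, every nonzero $p$-algebraic element of $L$ is $p$-semisimple. -/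

import Mathlib

universe u v

noncomputable section

open CategoryTheory

/-- For elements `x, y` of a Lie ring, `jacobsonCoeff x y n i` is the coefficient of `t ^ i` in
`(ad (t x + y)) ^ n (x)`, where `t` is an indeterminate. -/
def jacobsonCoeff {L : Type v} [LieRing L] (x y : L) : ℕ → ℕ → L
  | 0, 0 => x
  | 0, _ + 1 => 0
  | n + 1, 0 => ⁅y, jacobsonCoeff x y n 0⁆
  | n + 1, i + 1 => ⁅x, jacobsonCoeff x y n i⁆ + ⁅y, jacobsonCoeff x y n (i + 1)⁆

/-- A Lie `p`-algebra (restricted Lie algebra) structure on a Lie algebra `L` over `K`: a `p`-map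
`x ↦ x^[p]` with `(c x)^[p] = c^p x^[p]`, `ad (x^[p]) = (ad x)^p`, and
`(x + y)^[p] = x^[p] + y^[p] + ∑_{i=1}^{p-1} s_i(x, y)`, where `i s_i(x, y)` is the coefficient of
`t^(i-1)` in `(ad (t x + y))^(p-1) (x)`. -/
class LiePAlgebra (p : ℕ) (K : Type u) (L : Type v) [Field K] [LieRing L] [LieAlgebra K L] where
  /-- the `p`-map `x ↦ x^[p]` -/
  pMap : L → L
  pMap_smul : ∀ (c : K) (x : L), pMap (c • x) = c ^ p • pMap x
  pMap_lie : ∀ x y : L, ⁅pMap x, y⁆ = (LieAlgebra.ad K L x ^ p) y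
  pMap_add : ∀ x y : L, pMap (x + y) = pMap x + pMap y +
    ∑ i ∈ Finset.Icc 1 (p - 1), (i : K)⁻¹ • jacobsonCoeff x y (p - 1) (i - 1)

section Basic

variable (p : ℕ) (K : Type u) {L : Type v} [Field K] [LieRing L] [LieAlgebra K L]
  [LiePAlgebra p K L]

/-- The iterated `p`-map `x ↦ x^{[p]^k}`. -/
def pPow (k : ℕ) (x : L) : L := (LiePAlgebra.pMap p K)^[k] x

/-- `x` is `p`-algebraic if it is annihilated by a nonzero `p`-polynomial, that is, if its
`p`-powers `x, x^[p], x^{[p]^2}, …` are linearly dependent. -/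
def IsPAlgebraic (x : L) : Prop := ¬ LinearIndependent K (fun k : ℕ => pPow p K k x)

/-- `x` is `p`-semisimple if it is a linear combination of `x^{[p]^k}`, `k = 1, 2, …`. -/
def IsPSemisimple (x : L) : Prop :=
  x ∈ Submodule.span K (Set.range fun k : ℕ => pPow p K (k + 1) x)

variable (L) in
/-- A torus: an abelian Lie `p`-algebra in which each element is a linear combination of its
`p`-powers `x^{[p]^k}`, `k = 1, 2, …`. -/
def IsPTorus : Prop := IsLieAbelian L ∧ ∀ x : L, IsPSemisimple p K x

end Basic

/-- A `p`-subalgebra of a Lie `p`-algebra: a Lie subalgebra closed under the `p`-map. -/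
structure LiePSubalgebra (p : ℕ) (K : Type u) (L : Type v) [Field K] [LieRing L] [LieAlgebra K L]
    [LiePAlgebra p K L] extends LieSubalgebra K L where
  pMap_mem' : ∀ x : L, x ∈ toLieSubalgebra → LiePAlgebra.pMap p K x ∈ toLieSubalgebra

section Subalgebra

variable {p : ℕ} {K : Type u} {L : Type v} [Field K] [LieRing L] [LieAlgebra K L]

theorem jacobsonCoeff_coe (S : LieSubalgebra K L) (x y : S) (n i : ℕ) :
    ((jacobsonCoeff x y n i : S) : L) = jacobsonCoeff (x : L) (y : L) n i := by
  induction n generalizing i with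
  | zero => cases i <;> simp [jacobsonCoeff]
  | succ n ih => cases i <;> simp [jacobsonCoeff, ih]

theorem ad_pow_coe (S : LieSubalgebra K L) (x y : S) (n : ℕ) :
    (((LieAlgebra.ad K S x ^ n) y : S) : L) = (LieAlgebra.ad K L (x : L) ^ n) (y : L) := by
  induction n with
  | zero => simp
  | succ n ih => simp [pow_succ', ih]

/-- A `p`-subalgebra is a Lie `p`-algebra under the restricted `p`-map. -/
instance LiePSubalgebra.instLiePAlgebra [LiePAlgebra p K L] (S : LiePSubalgebra p K L) :
    LiePAlgebra p K S.toLieSubalgebra where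
  pMap x := ⟨LiePAlgebra.pMap p K (x : L), S.pMap_mem' x x.2⟩
  pMap_smul c x := Subtype.ext (by simpa using LiePAlgebra.pMap_smul c (x : L))
  pMap_lie x y := Subtype.ext (by
    rw [ad_pow_coe]
    exact LiePAlgebra.pMap_lie (x : L) (y : L))
  pMap_add x y := Subtype.ext (by
    simpa [jacobsonCoeff_coe] using LiePAlgebra.pMap_add (p := p) (K := K) (x : L) (y : L))

end Subalgebra

section Enveloping

attribute [local instance] LieRing.ofAssociativeRing

variable (p : ℕ) (K : Type u) (L : Type v) [Field K] [LieRing L] [LieAlgebra K L]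
  [LiePAlgebra p K L]

/-- The relations `x^p = x^[p]`, `x ∈ L`, in the universal enveloping algebra. -/
inductive RestrictedEnvelopingAlgebra.Rel :
    UniversalEnvelopingAlgebra K L → UniversalEnvelopingAlgebra K L → Prop
  | pow_eq (x : L) : Rel (UniversalEnvelopingAlgebra.ι K x ^ p)
      (UniversalEnvelopingAlgebra.ι K (LiePAlgebra.pMap p K x : L))

/-- The restricted universal enveloping algebra `u(L)`: the quotient of `U(L)` by the two-sided
ideal generated by all `x^p - x^[p]`, `x ∈ L`. -/
abbrev RestrictedEnvelopingAlgebra : Type (max u v) :=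
  RingQuot (RestrictedEnvelopingAlgebra.Rel p K L)

/-- The augmentation `u(L) → K`, which sends every `x ∈ L` to `0`. -/
def RestrictedEnvelopingAlgebra.augmentation [Fact p.Prime] :
    RestrictedEnvelopingAlgebra p K L →ₐ[K] K :=
  RingQuot.liftAlgHom K ⟨UniversalEnvelopingAlgebra.lift K (0 : L →ₗ⁅K⁆ K), by
    intro a b h
    cases h with
    | pow_eq x =>
      rw [map_pow, UniversalEnvelopingAlgebra.lift_ι_apply,
        UniversalEnvelopingAlgebra.lift_ι_apply]
      simp [(Fact.out : p.Prime).ne_zero]⟩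

/-- The trivial right `u(L)`-module `K`. Right `u(L)`-modules are modules over the opposite ring;
`ULift` only places `K` in the universe of `u(L)`. -/
def trivialRestrictedModule [Fact p.Prime] :
    ModuleCat.{max u v} (RestrictedEnvelopingAlgebra p K L)ᵐᵒᵖ :=
  (ModuleCat.restrictScalars
    ((RestrictedEnvelopingAlgebra.augmentation p K L).toRingHom.fromOpposite
      (fun _ _ => Commute.all _ _))).obj (ModuleCat.of K (ULift.{max u v} K))

/-- The restricted cohomological dimension `cd_*(L)`: the projective dimension of the trivial
right module `K` over the restricted universal enveloping algebra `u(L)`. -/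
def restrictedCohomologicalDimension [Fact p.Prime] : WithBot ℕ∞ :=
  projectiveDimension (trivialRestrictedModule p K L)

end Enveloping

end

/-!
Let `S` be a finite-dimensional `p`-subalgebra of `L`, where `cd_*(L) < ∞`. The proof that `S` is a
torus has three steps.

*Finite cohomological dimension passes to `S` and collapses there.* By the Poincaré–Birkhoff–Witt
theorem (`pbwBasis`), `u(L)` is a free module over `u(S)` (`free_of_injective`), so projective
`u(L)`-modules restrict to projective `u(S)`-modules and the trivial `u(S)`-module has a finite
projective resolution. But `u(S)` is a Frobenius algebra: the coefficient of the longest normal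
monomial is a nondegenerate linear form (`exists_topCoeff_mul_ne_zero`). Hence projective modules
are injective (`exists_leftInverse_of_frobenius`), a finite projective resolution splits,
and the trivial module is itself projective (`projective_of_hasProjectiveDimensionLE`). Thus the
augmentation splits: there is `θ ∈ u(S)` with `ε(θ) = 1` and `θ a = ε(a) θ` (`exists_integral`).

*Central extensions of `S` split.* Let `E → S` have kernel `K z` with `z` central and `z^[p] = 0`.
If `t ∈ u(E)` lifts `θ`, then `t a` lies in `u(E) z` whenever `ε(a) = 0`, so the coefficient of `z`
in `t a` is a linear form in `a` that vanishes on products of two elements of the augmentation ideal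
and takes the value `1` at `z` (`exists_character_of_central`). Its restriction to `E` is a
character that kills `p`-th powers. For a Frobenius-semilinear form `φ` on `S`, applying this to
`S × K` with `(x, a)^[p] = (x^[p], -φ x)` gives a character `χ` of `S` such that `χ (x^[p]) = φ x`
(`exists_character_pMap_eq`).

*Conclusion.* With `φ` the `p`-th powers of the coordinates of a basis, the resulting characters
separate the points of `S`, so `S` is abelian; moreover the `p`-map preserves linear independence
(`linearIndependent_pMap`). If `x` were not in the span of `x^[p], x^[p]^2, …`, then by induction
`x, x^[p], …, x^[p]^m` would be linearly independent for all `m` (`isPTorus_of_integral`).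

A `p`-algebraic element generates a finite-dimensional `p`-subalgebra
(`exists_finiteDimensional_of_isPAlgebraic`), which is a torus by the above.

The Poincaré–Birkhoff–Witt theorem is proved by rewriting words in an ordered basis: the only
nontrivial point is that the rules `y x → x y + [y, x]` and `x^p → x^[p]` are confluent
(`relationsReduce`), which comes down to the Jacobi identity and to `ad (x^[p]) = (ad x)^p`.
-/

attribute [local instance] LieRing.ofAssociativeRing

/-! ### Jacobson's formula for `p`-th powers -/

section Jacobson

variable {p : ℕ} [hp : Fact p.Prime]

theorem natCast_choose_pred_prime (R : Type*) [Ring R] [CharP R p] {m : ℕ} (hm : m ≤ p - 1) :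
    ((p - 1).choose m : R) = (-1) ^ m := by
  induction m with
  | zero => simp
  | succ m ih =>
    have h1 : (p - 1).choose m + (p - 1).choose (m + 1) = p.choose (m + 1) := by
      rw [← Nat.choose_succ_succ, Nat.succ_eq_add_one, Nat.sub_add_cancel hp.out.one_le]
    have h2 : ((p.choose (m + 1) : ℕ) : R) = 0 :=
      (CharP.cast_eq_zero_iff R p _).2 (hp.out.dvd_choose_self (by omega) (by omega))
    have h3 := ih (by omega)
    rw [← h1, Nat.cast_add, h3] at h2
    rw [pow_succ, mul_neg_one]
    exact (neg_eq_of_add_eq_zero_right h2).symm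

theorem Commute.sub_pow_pred_prime {R : Type*} [Ring R] [CharP R p] {x y : R} (h : Commute x y) :
    (x - y) ^ (p - 1) = ∑ k ∈ Finset.range p, x ^ k * y ^ (p - 1 - k) := by
  rw [sub_eq_add_neg, (h.neg_right).add_pow, Nat.sub_add_cancel hp.out.one_le]
  refine Finset.sum_congr rfl fun k hk => ?_
  have hk' : k ≤ p - 1 := by have := Finset.mem_range.1 hk; omega
  rw [← Nat.choose_symm hk', natCast_choose_pred_prime R (Nat.sub_le _ _), mul_assoc,
    ← (Commute.neg_one_right (-y)).mul_pow, neg_mul_neg, mul_one]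

variable (K : Type*) [Field K] [CharP K p] {A : Type*} [Ring A] [Algebra K A]

theorem ad_pow_pred_prime_apply (a b : A) :
    (LieAlgebra.ad K A a ^ (p - 1)) b = ∑ k ∈ Finset.range p, a ^ k * b * a ^ (p - 1 - k) := by
  nontriviality A
  have : CharP (Module.End K A) p := charP_of_injective_algebraMap
    (FaithfulSMul.algebraMap_injective K (Module.End K A)) p
  rw [LieAlgebra.ad_eq_lmul_left_sub_lmul_right, Pi.sub_apply,
    Commute.sub_pow_pred_prime (p := p) (LinearMap.commute_mulLeft_right (R := K) a a),
    LinearMap.sum_apply]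
  refine Finset.sum_congr rfl fun k _ => ?_
  rw [LinearMap.pow_mulLeft, LinearMap.pow_mulRight, Module.End.mul_apply]
  simp [mul_assoc]

theorem derivative_pow_noncomm {R : Type*} [Ring R] (f : Polynomial R) (n : ℕ) :
    (f ^ n).derivative = ∑ k ∈ Finset.range n, f ^ k * f.derivative * f ^ (n - 1 - k) := by
  induction n with
  | zero => simp
  | succ n ih =>
    rw [pow_succ, Polynomial.derivative_mul, ih, Finset.sum_range_succ, Finset.sum_mul]
    congr 1
    · refine Finset.sum_congr rfl fun k hk => ?_
      have : n + 1 - 1 - k = n - 1 - k + 1 := by have := Finset.mem_range.1 hk; omega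
      rw [this, pow_succ, ← mul_assoc]
    · simp

open Polynomial in
theorem coeff_ad_pow_eq_jacobsonCoeff (x y : A) (n i : ℕ) :
    ((LieAlgebra.ad K A[X] (X * C x + C y) ^ n) (C x)).coeff i = jacobsonCoeff x y n i := by
  induction n generalizing i with
  | zero => cases i <;> simp [jacobsonCoeff, coeff_C]
  | succ n ih =>
    have key : ∀ g : A[X], ⁅X * C x + C y, g⁆ =
        X * (C x * g) - (g * C x) * X + (C y * g - g * C y) := by
      intro g
      rw [LieRing.of_associative_ring_bracket, X_mul_C x]
      rw [add_mul, mul_add, ← X_mul_C x, mul_assoc X, X_mul_C x, ← mul_assoc g]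
      abel
    rw [pow_succ', Module.End.mul_apply, LieAlgebra.ad_apply, key]
    generalize (LieAlgebra.ad K A[X] (X * C x + C y) ^ n) (C x) = g at ih ⊢
    cases i with
    | zero => simp [jacobsonCoeff, ih, LieRing.of_associative_ring_bracket]
    | succ i =>
      simp [jacobsonCoeff, ih, LieRing.of_associative_ring_bracket, coeff_X_mul, coeff_mul_X]

open Polynomial in
/-- Jacobson's formula: the `p`-th power map of an associative algebra of characteristic `p`
satisfies the addition law of a restricted Lie algebra. -/
theorem add_pow_prime_eq_jacobson (x y : A) :
    (x + y) ^ p = x ^ p + y ^ p +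
      ∑ i ∈ Finset.Icc 1 (p - 1), (i : K)⁻¹ • jacobsonCoeff x y (p - 1) (i - 1) := by
  -- The coefficients of `(t x + y) ^ p` are found by differentiating with respect to `t`.
  set f : A[X] := X * C x + C y with hf
  have hp1 := hp.out.one_le
  have hdf : f.derivative = C x := by simp [hf]
  have hder : (f ^ p).derivative = (LieAlgebra.ad K A[X] f ^ (p - 1)) (C x) := by
    rw [derivative_pow_noncomm, ad_pow_pred_prime_apply, hdf]
  have hcoeff : ∀ i ∈ Finset.Icc 1 (p - 1),
      (f ^ p).coeff i = (i : K)⁻¹ • jacobsonCoeff x y (p - 1) (i - 1) := by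
    intro i hi
    rw [Finset.mem_Icc] at hi
    have h1 := congrArg (fun g => coeff g (i - 1)) hder
    simp only [coeff_derivative] at h1
    rw [hf, coeff_ad_pow_eq_jacobsonCoeff, ← hf, Nat.sub_add_cancel hi.1] at h1
    have hi0 : (i : K) ≠ 0 := by
      rw [Ne, CharP.cast_eq_zero_iff K p]
      exact Nat.not_dvd_of_pos_of_lt hi.1 (by omega)
    have h2 : ((i - 1 : ℕ) : A) + 1 = algebraMap K A i := by
      rw [map_natCast, ← Nat.cast_succ, Nat.succ_eq_add_one, Nat.sub_add_cancel hi.1]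
    rw [← h1, h2, ← Algebra.commutes, ← Algebra.smul_def, inv_smul_smul₀ hi0]
  have hdeg : f.natDegree ≤ 1 := by rw [hf]; compute_degree
  have h0 : (f ^ p).coeff 0 = y ^ p := by
    rw [← Polynomial.constantCoeff_apply, map_pow]
    simp [hf]
  have htop : (f ^ p).coeff p = x ^ p := by
    have := coeff_pow_of_natDegree_le (m := p) hdeg
    rw [mul_one] at this
    rw [this]
    simp [hf, coeff_C]
  have heval : (x + y) ^ p = eval 1 (f ^ p) := by
    have := map_pow (eval₂RingHom' (RingHom.id A) 1 (fun a => Commute.one_right a)) f p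
    have h2 : eval₂RingHom' (RingHom.id A) 1 (fun a => Commute.one_right a) f = x + y := by
      change eval₂ (RingHom.id A) 1 f = x + y
      rw [← Polynomial.eval, hf, X_mul_C]
      simp
    rw [h2] at this
    rw [← this]
    rfl
  have hdegp : (f ^ p).natDegree < p + 1 := by
    have := natDegree_pow_le_of_le p hdeg
    omega
  rw [heval, eval_eq_sum_range' hdegp, Finset.sum_range_succ, ← Finset.sum_congr rfl hcoeff, htop,
    show Finset.Icc 1 (p - 1) = (Finset.range p).erase 0 by
      ext i; simp only [Finset.mem_Icc, Finset.mem_erase, Finset.mem_range]; omega,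
    ← Finset.add_sum_erase _ _ (Finset.mem_range.2 hp.out.pos), h0]
  simp only [one_pow, mul_one]
  abel

end Jacobson

noncomputable section

/-! ### Words and their reduction in the free algebra -/

section Words

variable {I : Type*} [LinearOrder I] {p : ℕ}

/-- The words in normal form: the nondecreasing words in which no letter occurs `p` times. They
index the Poincaré–Birkhoff–Witt basis of a restricted enveloping algebra. -/
def IsRestrictedWord (p : ℕ) (w : List I) : Prop :=
  w.Pairwise (· ≤ ·) ∧ ∀ i, w.count i < p

theorem isRestrictedWord_nil [hp : Fact p.Prime] : IsRestrictedWord p ([] : List I) :=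
  ⟨List.Pairwise.nil, fun i => by simpa using hp.out.pos⟩

theorem IsRestrictedWord.tail {i : I} {w : List I} (h : IsRestrictedWord p (i :: w)) :
    IsRestrictedWord p w :=
  ⟨(List.pairwise_cons.1 h.1).2, fun j => (List.count_le_count_cons).trans_lt (h.2 j)⟩

theorem exists_eq_replicate_append {i : I} {n : ℕ} {w : List I} (hw : w.Pairwise (· ≤ ·))
    (hi : ∀ j ∈ w, i ≤ j) (hn : n ≤ w.count i) : ∃ w', w = List.replicate n i ++ w' := by
  induction w generalizing n with
  | nil => exact ⟨[], by simp at hn; simp [hn]⟩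
  | cons j w ih =>
    cases n with
    | zero => exact ⟨j :: w, by simp⟩
    | succ n =>
      rw [List.pairwise_cons] at hw
      have hij : j = i := by
        by_contra hne
        have hmem : i ∈ w := by
          have : i ∈ j :: w := List.count_pos_iff.1 (by omega)
          exact (List.mem_cons.1 this).resolve_left (Ne.symm hne)
        exact hne (le_antisymm (hw.1 i hmem) (hi j (by simp)))
      subst hij
      rw [List.count_cons_self] at hn
      obtain ⟨w', hw'⟩ := ih (n := n) hw.2 (fun k hk => hi k (by simp [hk])) (by omega)
      exact ⟨w', by simp [List.replicate_succ, ← hw']⟩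

theorem exists_of_not_isRestrictedWord_cons [Fact p.Prime] {i : I} {v : List I}
    (hv : IsRestrictedWord p v) (h : ¬ IsRestrictedWord p (i :: v)) :
    (∃ j v', j < i ∧ v = j :: v') ∨ ∃ v', v = List.replicate (p - 1) i ++ v' := by
  by_cases hle : ∀ j ∈ v, i ≤ j
  · right
    refine exists_eq_replicate_append hv.1 hle ?_
    by_contra hc
    refine h ⟨List.pairwise_cons.2 ⟨hle, hv.1⟩, fun j => ?_⟩
    by_cases hj : i = j
    · subst hj
      rw [List.count_cons_self]
      omega
    · rw [List.count_cons_of_ne hj]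
      exact hv.2 j
  · left
    push Not at hle
    obtain ⟨j, hj, hji⟩ := hle
    cases v with
    | nil => simp at hj
    | cons k v =>
      refine ⟨k, v, ?_, rfl⟩
      rcases List.mem_cons.1 hj with rfl | hj
      · exact hji
      · exact ((List.pairwise_cons.1 hv.1).1 j hj).trans_lt hji

theorem exists_of_not_isRestrictedWord_replicate [hp : Fact p.Prime] {i : I} {v : List I}
    (hv : IsRestrictedWord p v) (h : ¬ IsRestrictedWord p (List.replicate (p - 1) i ++ v)) :
    ∃ j v', j ≤ i ∧ v = j :: v' := by
  cases v with
  | nil =>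
    refine absurd ⟨?_, fun j => ?_⟩ h
    · simp [List.pairwise_replicate]
    · have := hp.out.pos
      rw [List.append_nil, List.count_replicate]
      split_ifs <;> omega
  | cons k v =>
    refine ⟨k, v, ?_, rfl⟩
    by_contra hk
    rw [not_le] at hk
    have hlt : ∀ j ∈ k :: v, i < j := by
      intro j hj
      rcases List.mem_cons.1 hj with rfl | hj
      · exact hk
      · exact hk.trans_le ((List.pairwise_cons.1 hv.1).1 j hj)
    refine h ⟨?_, fun j => ?_⟩
    · rw [List.pairwise_append]
      refine ⟨by simp [List.pairwise_replicate], hv.1, fun a ha c hc => ?_⟩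
      rw [List.eq_of_mem_replicate ha]
      exact (hlt c hc).le
    · rw [List.count_append, List.count_replicate]
      by_cases hij : i = j
      · subst hij
        have : List.count i (k :: v) = 0 := List.count_eq_zero.2 fun hi => lt_irrefl _ (hlt i hi)
        have := hp.out.pos
        simp only [beq_self_eq_true, if_true]
        omega
      · simpa [hij] using hv.2 j

end Words

section Reduction

open List (Shortlex)

variable (p : ℕ) (K : Type*) {L : Type*} {I : Type*}
variable [Field K] [LieRing L] [LieAlgebra K L] [LiePAlgebra p K L]

/-- The monomial of the free algebra given by a word. -/
def freeWord (w : List I) : FreeAlgebra K I := (w.map (FreeAlgebra.ι K)).prod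

@[simp] theorem freeWord_nil : freeWord K ([] : List I) = 1 := rfl

@[simp] theorem freeWord_cons (i : I) (w : List I) :
    freeWord K (i :: w) = FreeAlgebra.ι K i * freeWord K w := by simp [freeWord]

@[simp] theorem freeWord_append (v w : List I) :
    freeWord K (v ++ w) = freeWord K v * freeWord K w := by simp [freeWord]

@[simp] theorem freeWord_replicate (n : ℕ) (i : I) :
    freeWord K (List.replicate n i) = FreeAlgebra.ι K i ^ n := by simp [freeWord]

variable (I) in
/-- The basis of the free algebra consisting of the words. -/
def freeWordBasis : Module.Basis (List I) K (FreeAlgebra K I) :=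
  (FreeAlgebra.basisFreeMonoid K I).reindex FreeMonoid.toList

@[simp] theorem freeWordBasis_apply (w : List I) : freeWordBasis K I w = freeWord K w := by
  have : ∀ w : List I, (FreeAlgebra.equivMonoidAlgebraFreeMonoid (R := K) (X := I)) (freeWord K w) =
      MonoidAlgebra.of K (FreeMonoid I) (FreeMonoid.ofList w) := by
    intro w
    induction w with
    | nil => rw [freeWord_nil, map_one]; rfl
    | cons i w ih =>
      rw [freeWord_cons, map_mul, ih, FreeMonoid.ofList_cons, map_mul]
      congr 1
      simp [FreeAlgebra.equivMonoidAlgebraFreeMonoid]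
  rw [freeWordBasis, Module.Basis.reindex_apply]
  simp only [FreeAlgebra.basisFreeMonoid, Module.Basis.map_apply]
  rw [← (FreeAlgebra.equivMonoidAlgebraFreeMonoid (R := K) (X := I)).injective.eq_iff, this]
  simp

variable {K}

/-- The linear embedding of `L` into the free algebra on the index set of a basis. -/
def letters (b : Module.Basis I K L) : L →ₗ[K] FreeAlgebra K I := b.constr K (FreeAlgebra.ι K)

@[simp] theorem letters_basis (b : Module.Basis I K L) (i : I) :
    letters b (b i) = FreeAlgebra.ι K i := by simp [letters]

theorem letters_mul_mem (b : Module.Basis I K L) (x : L) {S : Submodule K (FreeAlgebra K I)}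
    {a : FreeAlgebra K I} (h : ∀ i, FreeAlgebra.ι K i * a ∈ S) : letters b x * a ∈ S := by
  have : Submodule.map ((LinearMap.mulRight K a) ∘ₗ letters b) ⊤ ≤ S := by
    rw [← b.span_eq, Submodule.map_span_le]
    rintro _ ⟨i, rfl⟩
    simpa using h i
  exact this ⟨x, trivial, rfl⟩

variable [LinearOrder I] (b : Module.Basis I K L)

/-- The rewriting of a word `i v` which is not in normal form although `v` is: a descent at its
head is commuted away, and a `p`-th power at its head is replaced by the `p`-map. In the second
case `j = i` and `v` begins with `p - 2` more letters `i`. -/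
def headReduct (i : I) : List I → FreeAlgebra K I
  | [] => 0
  | j :: v =>
    if j < i then freeWord K (j :: i :: v) + letters b ⁅b i, b j⁆ * freeWord K v
    else letters b (LiePAlgebra.pMap p K (b i)) * freeWord K (v.drop (p - 2))

open Classical in
/-- The rewriting of a word which is not in normal form, at the rightmost possible position. -/
def reduct : List I → FreeAlgebra K I
  | [] => 0
  | i :: v => if IsRestrictedWord p v then headReduct p b i v else FreeAlgebra.ι K i * reduct v

variable (K) in
/-- The span of the words smaller than `w` in the shortlex order. -/
def smallerSpan (w : List I) : Submodule K (FreeAlgebra K I) :=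
  Submodule.span K (freeWord K '' {v | Shortlex (· < ·) v w})

theorem ι_mul_mem_smallerSpan {i : I} {w : List I} {a : FreeAlgebra K I}
    (ha : a ∈ smallerSpan K w) : FreeAlgebra.ι K i * a ∈ smallerSpan K (i :: w) := by
  have : Submodule.map (LinearMap.mulLeft K (FreeAlgebra.ι K i)) (smallerSpan K w) ≤
      smallerSpan K (i :: w) := by
    rw [smallerSpan, Submodule.map_span_le]
    rintro _ ⟨v, hv, rfl⟩
    exact Submodule.subset_span ⟨i :: v, List.Shortlex.cons hv, by simp⟩
  exact this ⟨a, ha, rfl⟩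

theorem letters_mul_mem_smallerSpan {x : L} {v w : List I} (h : v.length + 1 < w.length) :
    letters b x * freeWord K v ∈ smallerSpan K w := by
  refine letters_mul_mem b x fun i => Submodule.subset_span ⟨i :: v, ?_, by simp⟩
  exact List.Shortlex.of_length_lt (by simpa using h)

theorem shortlex_cons_of_lt {i j : I} {v w : List I} (h : j < i) (hl : v.length = w.length) :
    Shortlex (· < ·) (j :: v) (i :: w) :=
  List.Shortlex.of_lex (by simp [hl]) (List.Lex.rel h)

theorem headReduct_mem [hp : Fact p.Prime] {i : I} {v : List I} (hv : IsRestrictedWord p v)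
    (h : ¬ IsRestrictedWord p (i :: v)) : headReduct p b i v ∈ smallerSpan K (i :: v) := by
  have h2 := hp.out.two_le
  rcases v with - | ⟨j, v⟩
  · exact Submodule.zero_mem _
  rw [headReduct]
  split_ifs with hj
  · refine add_mem (Submodule.subset_span ⟨_, ?_, rfl⟩) (letters_mul_mem_smallerSpan b (by simp))
    exact shortlex_cons_of_lt hj (by simp)
  · refine letters_mul_mem_smallerSpan b ?_
    simp only [List.length_drop, List.length_cons]
    omega

theorem reduct_mem [Fact p.Prime] {w : List I} (h : ¬ IsRestrictedWord p w) :
    reduct p b w ∈ smallerSpan K w := by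
  induction w with
  | nil => exact absurd isRestrictedWord_nil h
  | cons i v ih =>
    rw [reduct]
    split_ifs with hv
    · exact headReduct_mem p b hv h
    · exact ι_mul_mem_smallerSpan (ih hv)

/-- The left ideal of the free algebra spanned by the differences of the words and their
rewritings. That it contains the relations of the restricted enveloping algebra multiplied on the
right by any word is the confluence of the rewriting system. -/
def reductionIdeal : Ideal (FreeAlgebra K I) where
  __ := Submodule.span K ((fun w => freeWord K w - reduct p b w) '' {w | ¬ IsRestrictedWord p w})
  smul_mem' := by
    intro a x hx
    change a * x ∈ Submodule.span K _
    replace hx : x ∈ Submodule.span K _ := hx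
    induction a using FreeAlgebra.induction generalizing x with
    | grade0 r =>
      rw [← Algebra.smul_def]
      exact Submodule.smul_mem _ _ hx
    | grade1 i =>
      refine (Submodule.map_span_le (LinearMap.mulLeft K (FreeAlgebra.ι K i)) _ _).2 ?_
        ⟨x, hx, rfl⟩
      rintro _ ⟨w, hw, rfl⟩
      refine Submodule.subset_span ⟨i :: w, fun h => hw h.tail, ?_⟩
      simp [reduct, if_neg (show ¬ IsRestrictedWord p w from hw), mul_sub]
    | mul a c ha hc =>
      rw [mul_assoc]
      exact ha (hc hx)
    | add a c ha hc =>
      rw [add_mul]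
      exact add_mem (ha hx) (hc hx)

theorem mem_reductionIdeal_iff {x : FreeAlgebra K I} : x ∈ reductionIdeal p b ↔
    x ∈ Submodule.span K
      ((fun w => freeWord K w - reduct p b w) '' {w | ¬ IsRestrictedWord p w}) := Iff.rfl

theorem smul_mem_reductionIdeal (c : K) {x : FreeAlgebra K I} (hx : x ∈ reductionIdeal p b) :
    c • x ∈ reductionIdeal p b := Submodule.smul_mem (Submodule.span K _) c hx

theorem freeWord_sub_reduct_mem {w : List I} (h : ¬ IsRestrictedWord p w) :
    freeWord K w - reduct p b w ∈ reductionIdeal p b := Submodule.subset_span ⟨w, h, rfl⟩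

end Reduction
end

noncomputable section

/-! ### Confluence of the reduction -/

theorem pow_mul_sub_mul_pow {A : Type*} [Ring A] (a e : A) (n : ℕ) :
    a ^ n * e - e * a ^ n = ∑ k ∈ Finset.range n, a ^ k * (a * e - e * a) * a ^ (n - 1 - k) := by
  induction n with
  | zero => simp
  | succ n ih =>
    rw [Finset.sum_range_succ, Nat.add_sub_cancel, Nat.sub_self, pow_zero, mul_one]
    have : ∑ k ∈ Finset.range n, a ^ k * (a * e - e * a) * a ^ (n - k) =
        (a ^ n * e - e * a ^ n) * a := by
      rw [ih, Finset.sum_mul]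
      refine Finset.sum_congr rfl fun k hk => ?_
      have hk' : n - k = n - 1 - k + 1 := by have := Finset.mem_range.1 hk; omega
      rw [hk', pow_succ, ← mul_assoc]
    rw [this, pow_succ]
    noncomm_ring

section Confluence

open List (Shortlex)

variable {p : ℕ} {K : Type*} {L : Type*} {I : Type*}
variable [Field K] [LieRing L] [LieAlgebra K L] [LiePAlgebra p K L]
variable [LinearOrder I] {b : Module.Basis I K L}

local notation "𝒦" => reductionIdeal p b
local notation "X_" => FreeAlgebra.ι K
local notation "ℓ" => letters b

variable (p b) in
/-- The relations of the restricted enveloping algebra whose leading word is a prefix of `w` lie,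
after multiplication on the right by the rest of `w`, in the reduction ideal. -/
def RelationsReduce (w : List I) : Prop :=
  (∀ i j c, j < i → w = i :: j :: c →
    (X_ i * X_ j - X_ j * X_ i - ℓ ⁅b i, b j⁆) * freeWord K c ∈ 𝒦) ∧
  ∀ i c, w = List.replicate p i ++ c →
    (X_ i ^ p - ℓ (LiePAlgebra.pMap p K (b i))) * freeWord K c ∈ 𝒦

variable (p b) in
/-- The commutator relations of length at most `m` hold in the quotient by the reduction ideal. -/
def CommutatorsReduce (m : ℕ) : Prop :=
  ∀ c : List I, c.length + 2 ≤ m → ∀ x y : L,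
    (ℓ x * ℓ y - ℓ y * ℓ x - ℓ ⁅x, y⁆) * freeWord K c ∈ 𝒦

theorem commutatorsReduce_of_relationsReduce {m : ℕ}
    (h : ∀ w : List I, w.length ≤ m → RelationsReduce p b w) : CommutatorsReduce p b m := by
  intro c hc x y
  have h1 : ∀ i j, j < i →
      (X_ i * X_ j - X_ j * X_ i - ℓ ⁅b i, b j⁆) * freeWord K c ∈ 𝒦 := fun i j hij =>
    (h (i :: j :: c) (by simp; omega)).1 i j c hij rfl
  have h2 : ∀ i j, (ℓ (b i) * ℓ (b j) - ℓ (b j) * ℓ (b i) - ℓ ⁅b i, b j⁆) * freeWord K c ∈ 𝒦 := by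
    intro i j
    rw [letters_basis, letters_basis]
    rcases lt_trichotomy j i with hij | rfl | hij
    · exact h1 i j hij
    · simp
    · have := neg_mem (h1 j i hij)
      rw [← lie_skew (b i) (b j), map_neg]
      convert this using 1
      noncomm_ring
  have h3 : ∀ i, (ℓ (b i) * ℓ y - ℓ y * ℓ (b i) - ℓ ⁅b i, y⁆) * freeWord K c ∈ 𝒦 := by
    intro i
    induction b.mem_span y using Submodule.span_induction with
    | zero => simp
    | mem _ hj =>
      obtain ⟨j, rfl⟩ := hj
      exact h2 i j
    | add y z _ _ hy hz =>
      convert add_mem hy hz using 1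
      rw [lie_add, map_add, map_add]
      noncomm_ring
    | smul r y _ hy =>
      convert smul_mem_reductionIdeal p b r hy using 1
      rw [lie_smul, map_smul, map_smul]
      simp only [mul_smul_comm, smul_mul_assoc, ← smul_sub]
  induction b.mem_span x using Submodule.span_induction with
  | zero => simp
  | mem _ hj =>
    obtain ⟨j, rfl⟩ := hj
    exact h3 j
  | add y z _ _ hy hz =>
    convert add_mem hy hz using 1
    rw [add_lie, map_add, map_add]
    noncomm_ring
  | smul r y _ hy =>
    convert smul_mem_reductionIdeal p b r hy using 1
    rw [smul_lie, map_smul, map_smul]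
    simp only [mul_smul_comm, smul_mul_assoc, ← smul_sub]

theorem ad_pow_sub_mem {m : ℕ} (h : CommutatorsReduce p b m) (i : I) (y : L) (n : ℕ) (c : List I)
    (hc : c.length + n + 1 ≤ m) :
    ((LieAlgebra.ad K (FreeAlgebra K I) (X_ i) ^ n) (ℓ y) -
      ℓ ((LieAlgebra.ad K L (b i) ^ n) y)) * freeWord K c ∈ 𝒦 := by
  induction n generalizing c with
  | zero => simp
  | succ n ih =>
    rw [pow_succ', Module.End.mul_apply, LieAlgebra.ad_apply, pow_succ', Module.End.mul_apply,
      LieAlgebra.ad_apply, LieRing.of_associative_ring_bracket]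
    have h1 := Ideal.mul_mem_left 𝒦 (X_ i) (ih c (by omega))
    have h2 := ih (i :: c) (by simp; omega)
    have h3 := h c (by omega) (b i) ((LieAlgebra.ad K L (b i) ^ n) y)
    rw [letters_basis] at h3
    rw [freeWord_cons] at h2
    convert add_mem (sub_mem h1 h2) h3 using 1
    noncomm_ring

/-- The overlap of two descents. -/
theorem overlap_descent_descent {i j k : I} {c : List I} (hji : j < i) (hkj : k < j)
    (ih : ∀ w, Shortlex (· < ·) w (i :: j :: k :: c) → RelationsReduce p b w) :
    (X_ i * X_ j - X_ j * X_ i - ℓ ⁅b i, b j⁆) * freeWord K (k :: c) ∈ 𝒦 := by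
  have hcomm : CommutatorsReduce p b (c.length + 2) :=
    commutatorsReduce_of_relationsReduce fun w hw => ih w (Shortlex.of_length_lt (by simp; omega))
  have r1 := Ideal.mul_mem_left 𝒦 (X_ i)
    ((ih (j :: k :: c) (Shortlex.of_length_lt (by simp))).1 j k c hkj rfl)
  have r2 := (ih (i :: k :: j :: c) (Shortlex.cons (shortlex_cons_of_lt hkj (by simp)))).1
    i k (j :: c) (hkj.trans hji) rfl
  have r3 := Ideal.mul_mem_left 𝒦 (X_ k)
    ((ih (i :: j :: c) (Shortlex.of_length_lt (by simp))).1 i j c hji rfl)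
  have r4 := Ideal.mul_mem_left 𝒦 (X_ j)
    ((ih (i :: k :: c) (Shortlex.of_length_lt (by simp))).1 i k c (hkj.trans hji) rfl)
  have r5 := (ih (j :: k :: i :: c) (shortlex_cons_of_lt hji (by simp))).1 j k (i :: c) hkj rfl
  have s1 := hcomm c le_rfl (b i) ⁅b j, b k⁆
  have s2 := hcomm c le_rfl ⁅b i, b k⁆ (b j)
  have s3 := hcomm c le_rfl (b k) ⁅b i, b j⁆
  have hJ : ℓ ⁅b i, ⁅b j, b k⁆⁆ + ℓ ⁅⁅b i, b k⁆, b j⁆ + ℓ ⁅b k, ⁅b i, b j⁆⁆ = 0 := by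
    rw [← map_add, ← map_add, ← lie_skew (⁅b i, b k⁆) (b j), ← lie_skew (b i) (b k), lie_neg,
      neg_neg, add_assoc, add_comm (⁅b j, _⁆), ← add_assoc]
    have := lie_jacobi (b i) (b j) (b k)
    rw [← map_zero ℓ, ← this]
    congr 1
    abel
  simp only [letters_basis] at s1 s2 s3
  rw [freeWord_cons] at r2 r5 ⊢
  have key := sub_mem (sub_mem (add_mem (add_mem (add_mem (add_mem (add_mem r1 r2) r3) s1) s2) s3)
    r4) r5
  rw [← sub_zero ((_ - _ - _) * _), ← zero_mul (freeWord K c), ← hJ]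
  convert key using 1
  noncomm_ring

theorem freeWord_cons_sub_headReduct_mem {i : I} {v : List I} (hv : IsRestrictedWord p v)
    (h : ¬ IsRestrictedWord p (i :: v)) :
    X_ i * freeWord K v - headReduct p b i v ∈ 𝒦 := by
  have := freeWord_sub_reduct_mem p b h
  rwa [reduct, if_pos hv, freeWord_cons] at this

variable [hp : Fact p.Prime]

theorem sum_pow_mul_letters_sub_mem [CharP K p] {m : ℕ} (h : CommutatorsReduce p b m) (i : I)
    (y : L) (c : List I) (hc : c.length + p ≤ m) :
    (∑ k ∈ Finset.range p, X_ i ^ k * ℓ y * X_ i ^ (p - 1 - k) -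
      ℓ ((LieAlgebra.ad K L (b i) ^ (p - 1)) y)) * freeWord K c ∈ 𝒦 := by
  rw [← ad_pow_pred_prime_apply K]
  exact ad_pow_sub_mem h i y (p - 1) c (by have := hp.out.pos; omega)

theorem ad_pow_pred_lie_eq (x y : L) :
    (LieAlgebra.ad K L x ^ (p - 1)) ⁅x, y⁆ = ⁅LiePAlgebra.pMap p K x, y⁆ := by
  rw [LiePAlgebra.pMap_lie, ← LieAlgebra.ad_apply (R := K), ← Module.End.mul_apply, ← pow_succ,
    Nat.sub_add_cancel hp.out.one_le]

/-- The overlap of a descent with a `p`-th power of the smaller letter. -/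
theorem overlap_descent_pow [CharP K p] {i j : I} {c : List I} (hji : j < i)
    (ih : ∀ w, Shortlex (· < ·) w (i :: (List.replicate p j ++ c)) → RelationsReduce p b w) :
    (X_ i * X_ j - X_ j * X_ i - ℓ ⁅b i, b j⁆) * freeWord K (List.replicate (p - 1) j ++ c)
      ∈ 𝒦 := by
  have hp1 := hp.out.pos
  have hcomm : CommutatorsReduce p b (c.length + p) :=
    commutatorsReduce_of_relationsReduce fun w hw => ih w (Shortlex.of_length_lt (by simp; omega))
  have r1 := Ideal.mul_mem_left 𝒦 (X_ i)
    ((ih (List.replicate p j ++ c) (Shortlex.of_length_lt (by simp))).2 j c rfl)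
  have r2 := (ih (List.replicate p j ++ (i :: c)) (by
    obtain ⟨n, rfl⟩ := Nat.exists_eq_add_of_lt hp1
    rw [zero_add, List.replicate_succ, List.cons_append]
    exact shortlex_cons_of_lt hji (by simp; omega))).2 j (i :: c) rfl
  have r3 := hcomm c (by have := hp.out.two_le; omega) (b i) (LiePAlgebra.pMap p K (b j))
  have r4 := sum_pow_mul_letters_sub_mem hcomm j ⁅b i, b j⁆ c le_rfl
  have hlie : ⁅b i, LiePAlgebra.pMap p K (b j)⁆ =
      (LieAlgebra.ad K L (b j) ^ (p - 1)) ⁅b i, b j⁆ := by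
    rw [← lie_skew, ← ad_pow_pred_lie_eq, ← map_neg, lie_skew]
  have r5 : ∑ k ∈ (Finset.range p).erase 0, X_ j ^ k *
      ((X_ i * X_ j - X_ j * X_ i - ℓ ⁅b i, b j⁆) *
        freeWord K (List.replicate (p - 1 - k) j ++ c)) ∈ 𝒦 := by
    refine sum_mem fun k hk => Ideal.mul_mem_left _ _ ?_
    rw [Finset.mem_erase, Finset.mem_range] at hk
    exact (ih (i :: j :: (List.replicate (p - 1 - k) j ++ c))
      (Shortlex.of_length_lt (by simp; omega))).1 i j _ hji rfl
  have hsum := Finset.add_sum_erase (Finset.range p) (fun k => X_ j ^ k *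
      ((X_ i * X_ j - X_ j * X_ i - ℓ ⁅b i, b j⁆) *
        freeWord K (List.replicate (p - 1 - k) j ++ c))) (Finset.mem_range.2 hp1)
  have htel := pow_mul_sub_mul_pow (X_ j) (X_ i) p
  have hsum' : ∑ k ∈ Finset.range p, X_ j ^ k *
      ((X_ i * X_ j - X_ j * X_ i - ℓ ⁅b i, b j⁆) *
        freeWord K (List.replicate (p - 1 - k) j ++ c)) =
      (X_ i * X_ j ^ p - X_ j ^ p * X_ i - ∑ k ∈ Finset.range p,
        X_ j ^ k * ℓ ⁅b i, b j⁆ * X_ j ^ (p - 1 - k)) * freeWord K c := by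
    rw [← neg_sub (X_ j ^ p * _), htel, ← Finset.sum_neg_distrib, ← Finset.sum_sub_distrib,
      Finset.sum_mul]
    refine Finset.sum_congr rfl fun k _ => ?_
    rw [freeWord_append, freeWord_replicate]
    noncomm_ring
  rw [pow_zero, one_mul, Nat.sub_zero, hsum'] at hsum
  rw [letters_basis] at r3
  rw [freeWord_cons] at r2
  rw [eq_sub_of_add_eq hsum]
  refine sub_mem ?_ r5
  have key := sub_mem (add_mem (sub_mem r1 r2) r3) r4
  convert key using 1
  rw [hlie]
  noncomm_ring

/-- The overlap of a `p`-th power with a descent to a smaller letter. -/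
theorem overlap_pow_descent [CharP K p] {i j : I} {c : List I} (hji : j < i)
    (ih : ∀ w, Shortlex (· < ·) w (List.replicate p i ++ j :: c) → RelationsReduce p b w) :
    (X_ i ^ p - ℓ (LiePAlgebra.pMap p K (b i))) * freeWord K (j :: c) ∈ 𝒦 := by
  have hp2 := hp.out.two_le
  have hcomm : CommutatorsReduce p b (c.length + p) :=
    commutatorsReduce_of_relationsReduce fun w hw => ih w (Shortlex.of_length_lt (by simp; omega))
  have r1 := Ideal.mul_mem_left 𝒦 (X_ j)
    ((ih (List.replicate p i ++ c) (Shortlex.of_length_lt (by simp))).2 i c rfl)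
  have r3 := hcomm c (by omega) (LiePAlgebra.pMap p K (b i)) (b j)
  have r4 := sum_pow_mul_letters_sub_mem hcomm i ⁅b i, b j⁆ c le_rfl
  have r5 : ∑ k ∈ Finset.range p, X_ i ^ k *
      ((X_ i * X_ j - X_ j * X_ i - ℓ ⁅b i, b j⁆) *
        freeWord K (List.replicate (p - 1 - k) i ++ c)) ∈ 𝒦 := by
    refine sum_mem fun k hk => Ideal.mul_mem_left _ _ ?_
    rw [Finset.mem_range] at hk
    refine (ih (i :: j :: (List.replicate (p - 1 - k) i ++ c)) ?_).1 i j _ hji rfl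
    rcases Nat.eq_zero_or_pos k with rfl | hk0
    · -- Here the two words have the same length and first differ in the second letter.
      obtain ⟨n, hn⟩ := Nat.exists_eq_add_of_le hp2
      rw [hn, add_comm 2 n, List.replicate_succ, List.replicate_succ, List.cons_append,
        List.cons_append]
      exact Shortlex.cons (shortlex_cons_of_lt hji (by simp; omega))
    · exact Shortlex.of_length_lt (by simp; omega)
  have htel := pow_mul_sub_mul_pow (X_ i) (X_ j) p
  have hsum' : ∑ k ∈ Finset.range p, X_ i ^ k *
      ((X_ i * X_ j - X_ j * X_ i - ℓ ⁅b i, b j⁆) *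
        freeWord K (List.replicate (p - 1 - k) i ++ c)) =
      (X_ i ^ p * X_ j - X_ j * X_ i ^ p - ∑ k ∈ Finset.range p,
        X_ i ^ k * ℓ ⁅b i, b j⁆ * X_ i ^ (p - 1 - k)) * freeWord K c := by
    rw [htel, ← Finset.sum_sub_distrib, Finset.sum_mul]
    refine Finset.sum_congr rfl fun k _ => ?_
    rw [freeWord_append, freeWord_replicate]
    noncomm_ring
  rw [hsum'] at r5
  rw [ad_pow_pred_lie_eq] at r4
  rw [letters_basis] at r3
  have key := sub_mem (add_mem (add_mem r5 r4) r1) r3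
  convert key using 1
  rw [freeWord_cons]
  noncomm_ring

/-- The overlap of two `p`-th powers of the same letter. -/
theorem overlap_pow_pow {i : I} {c : List I}
    (ih : ∀ w, Shortlex (· < ·) w (List.replicate p i ++ i :: c) → RelationsReduce p b w) :
    (X_ i ^ p - ℓ (LiePAlgebra.pMap p K (b i))) * freeWord K (i :: c) ∈ 𝒦 := by
  have hp2 := hp.out.two_le
  have hcomm : CommutatorsReduce p b (c.length + p) :=
    commutatorsReduce_of_relationsReduce fun w hw => ih w (Shortlex.of_length_lt (by simp; omega))
  have r1 := Ideal.mul_mem_left 𝒦 (X_ i)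
    ((ih (List.replicate p i ++ c) (Shortlex.of_length_lt (by simp))).2 i c rfl)
  have r3 := hcomm c (by omega) (b i) (LiePAlgebra.pMap p K (b i))
  have hlie : ⁅b i, LiePAlgebra.pMap p K (b i)⁆ = 0 := by
    rw [← lie_skew, ← ad_pow_pred_lie_eq, lie_self, map_zero, neg_zero]
  rw [letters_basis, hlie, map_zero, sub_zero] at r3
  convert add_mem r1 r3 using 1
  have : X_ i ^ p * X_ i = X_ i * X_ i ^ p := (pow_mul_comm' _ _)
  rw [freeWord_cons, sub_mul, sub_mul, sub_mul, ← mul_assoc, this]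
  noncomm_ring

theorem mul_freeWord_mem_of_not_isRestrictedWord {r : FreeAlgebra K I} {c : List I}
    (hc : ¬ IsRestrictedWord p c) (h : ∀ v, Shortlex (· < ·) v c → r * freeWord K v ∈ 𝒦) :
    r * freeWord K c ∈ 𝒦 := by
  have h1 := Ideal.mul_mem_left 𝒦 r (freeWord_sub_reduct_mem p b hc)
  have h2 : r * reduct p b c ∈ 𝒦 := by
    refine (Submodule.map_span_le (LinearMap.mulLeft K r) _
      (Submodule.span K _)).2 ?_ ⟨_, reduct_mem p b hc, rfl⟩
    rintro _ ⟨v, hv, rfl⟩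
    exact h v hv
  convert add_mem h1 h2 using 1
  noncomm_ring

/-- Confluence: every overlap of two rewriting rules is resolved, by the Jacobi identity and by
`ad x^[p] = (ad x)^p`. -/
theorem relationsReduce [CharP K p] [WellFoundedLT I] (w : List I) : RelationsReduce p b w := by
  have hp2 := hp.out.two_le
  induction w using (Shortlex.wf (r := ((· < ·) : I → I → Prop)) wellFounded_lt).induction with
  | h w ih =>
  refine ⟨?_, ?_⟩
  · rintro i j c hji rfl
    by_cases hc : IsRestrictedWord p c
    swap
    · exact mul_freeWord_mem_of_not_isRestrictedWord hc fun v hv =>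
        (ih (i :: j :: v) (Shortlex.cons (Shortlex.cons hv))).1 i j v hji rfl
    by_cases hjc : IsRestrictedWord p (j :: c)
    · have hn : ¬ IsRestrictedWord p (i :: j :: c) := fun h =>
        absurd ((List.pairwise_cons.1 h.1).1 j (by simp)) (not_le.2 hji)
      convert freeWord_cons_sub_headReduct_mem hjc hn using 1
      rw [headReduct, if_pos hji]
      simp only [freeWord_cons]
      noncomm_ring
    · rcases exists_of_not_isRestrictedWord_cons hc hjc with ⟨k, c, hkj, rfl⟩ | ⟨c, rfl⟩
      · exact overlap_descent_descent hji hkj ih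
      · refine overlap_descent_pow hji ?_
        rwa [show i :: (List.replicate p j ++ c) = i :: j :: (List.replicate (p - 1) j ++ c) by
          rw [← List.cons_append (a := j), ← List.replicate_succ,
            Nat.sub_add_cancel (by omega)]]
  · rintro i c rfl
    by_cases hc : IsRestrictedWord p c
    swap
    · exact mul_freeWord_mem_of_not_isRestrictedWord hc fun v hv =>
        (ih (List.replicate p i ++ v) (hv.append_left _)).2 i v rfl
    by_cases hic : IsRestrictedWord p (List.replicate (p - 1) i ++ c)
    · obtain ⟨n, hn⟩ := Nat.exists_eq_add_of_le' hp2
      have hcount : ¬ IsRestrictedWord p (i :: (List.replicate (p - 1) i ++ c)) := fun h => by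
        have := h.2 i
        rw [List.count_cons_self, List.count_append, List.count_replicate_self] at this
        omega
      have := freeWord_cons_sub_headReduct_mem (b := b) hic hcount
      rw [show p - 1 = n + 1 by omega, List.replicate_succ, List.cons_append, headReduct,
        if_neg (lt_irrefl _), ← List.cons_append, ← List.replicate_succ,
        show p - 2 = n by omega, List.drop_left' (by simp), freeWord_append, freeWord_replicate,
        ← mul_assoc, ← pow_succ', show n + 1 + 1 = p by omega] at this
      rwa [sub_mul]
    · obtain ⟨j, c, hji, rfl⟩ := exists_of_not_isRestrictedWord_replicate hc hic
      rcases hji.lt_or_eq with hji | rfl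
      · exact overlap_pow_descent hji ih
      · exact overlap_pow_pow ih

end Confluence
end

noncomputable section

/-! ### The restricted enveloping algebra and its Poincaré–Birkhoff–Witt basis -/

namespace RestrictedEnvelopingAlgebra

section Universal

variable (p : ℕ) (K : Type u) {L : Type v} [Field K] [LieRing L] [LieAlgebra K L]
  [LiePAlgebra p K L]

/-- The canonical map `L → u(L)`. -/
def ι : L →ₗ[K] RestrictedEnvelopingAlgebra p K L :=
  (RingQuot.mkAlgHom K (Rel p K L)).toLinearMap ∘ₗ (UniversalEnvelopingAlgebra.ι K : L →ₗ⁅K⁆ _)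

theorem ι_eq (x : L) :
    ι p K x = RingQuot.mkAlgHom K (Rel p K L) (UniversalEnvelopingAlgebra.ι K x) := rfl

theorem ι_lie (x y : L) : ι p K ⁅x, y⁆ = ι p K x * ι p K y - ι p K y * ι p K x := by
  rw [ι_eq, LieHom.map_lie, LieRing.of_associative_ring_bracket, map_sub, map_mul, map_mul]
  rfl

theorem ι_pMap (x : L) : ι p K (LiePAlgebra.pMap p K x) = ι p K x ^ p := by
  rw [ι_eq, ι_eq, ← map_pow]
  exact (RingQuot.mkAlgHom_rel K (Rel.pow_eq x)).symm

variable {p K} {A : Type*} [Ring A] [Algebra K A]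

/-- The universal property of `u(L)`. -/
def lift (f : L →ₗ[K] A) (hlie : ∀ x y, f ⁅x, y⁆ = f x * f y - f y * f x)
    (hpow : ∀ x, f (LiePAlgebra.pMap p K x) = f x ^ p) :
    RestrictedEnvelopingAlgebra p K L →ₐ[K] A :=
  RingQuot.liftAlgHom K ⟨UniversalEnvelopingAlgebra.lift K
    { f with map_lie' := fun {x y} => hlie x y }, by
    rintro _ _ ⟨x⟩
    rw [map_pow, UniversalEnvelopingAlgebra.lift_ι_apply, UniversalEnvelopingAlgebra.lift_ι_apply]
    exact (hpow x).symm⟩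

@[simp]
theorem lift_ι (f : L →ₗ[K] A) (hlie : ∀ x y, f ⁅x, y⁆ = f x * f y - f y * f x)
    (hpow : ∀ x, f (LiePAlgebra.pMap p K x) = f x ^ p) (x : L) :
    lift f hlie hpow (ι p K x) = f x := by
  rw [ι_eq, lift, RingQuot.liftAlgHom_mkAlgHom_apply, UniversalEnvelopingAlgebra.lift_ι_apply]
  rfl

theorem algHom_ext' {f g : RestrictedEnvelopingAlgebra p K L →ₐ[K] A}
    (h : ∀ x, f (ι p K x) = g (ι p K x)) : f = g := by
  apply RingQuot.ringQuot_ext'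
  apply UniversalEnvelopingAlgebra.hom_ext
  ext x
  exact h x

variable (p K) in
@[simp]
theorem augmentation_ι [Fact p.Prime] (x : L) : augmentation p K L (ι p K x) = 0 := by
  rw [ι_eq, augmentation, RingQuot.liftAlgHom_mkAlgHom_apply,
    UniversalEnvelopingAlgebra.lift_ι_apply]
  rfl

end Universal

end RestrictedEnvelopingAlgebra

theorem pMap_zero (p : ℕ) [hp : Fact p.Prime] (K : Type*) {L : Type*} [Field K] [LieRing L]
    [LieAlgebra K L] [LiePAlgebra p K L] : LiePAlgebra.pMap p K (0 : L) = 0 := by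
  have := LiePAlgebra.pMap_smul (p := p) (0 : K) (0 : L)
  rwa [zero_smul, zero_pow hp.out.ne_zero, zero_smul] at this

theorem map_jacobsonCoeff {K L M : Type*} [Field K] [LieRing L] [LieAlgebra K L] [LieRing M]
    [LieAlgebra K M] (f : L →ₗ[K] M) (hlie : ∀ x y, f ⁅x, y⁆ = ⁅f x, f y⁆) (x y : L) (n i : ℕ) :
    f (jacobsonCoeff x y n i) = jacobsonCoeff (f x) (f y) n i := by
  induction n generalizing i with
  | zero => cases i <;> simp [jacobsonCoeff]
  | succ n ih => cases i <;> simp [jacobsonCoeff, ih, hlie]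

/-- Whether a Lie algebra representation is restricted can be tested on a basis. -/
theorem map_pMap_of_basis {p : ℕ} [hp : Fact p.Prime] {K L A I : Type*} [Field K] [CharP K p]
    [LieRing L] [LieAlgebra K L] [LiePAlgebra p K L] [Ring A] [Algebra K A]
    (b : Module.Basis I K L) (f : L →ₗ[K] A) (hlie : ∀ x y, f ⁅x, y⁆ = f x * f y - f y * f x)
    (hb : ∀ i, f (LiePAlgebra.pMap p K (b i)) = f (b i) ^ p) (x : L) :
    f (LiePAlgebra.pMap p K x) = f x ^ p := by
  induction b.mem_span x using Submodule.span_induction with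
  | mem _ h =>
    obtain ⟨i, rfl⟩ := h
    exact hb i
  | zero => simp [pMap_zero, hp.out.ne_zero]
  | add x y _ _ hx hy =>
    rw [LiePAlgebra.pMap_add, map_add, map_add, map_add, map_sum, hx, hy,
      add_pow_prime_eq_jacobson K]
    refine congrArg _ (Finset.sum_congr rfl fun i _ => ?_)
    rw [map_smul, map_jacobsonCoeff f (fun x y => by
      rw [LieRing.of_associative_ring_bracket, hlie])]
  | smul c x _ hx => rw [LiePAlgebra.pMap_smul, map_smul, map_smul, hx, smul_pow]

section PBW

open List (Shortlex)
open RestrictedEnvelopingAlgebra (ι)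

variable {p : ℕ} {K : Type u} {L : Type v} {I : Type*}
variable [Field K] [LieRing L] [LieAlgebra K L] [LiePAlgebra p K L]

/-- The product in `u(L)` of the basis elements named by a word. -/
def monomial (p : ℕ) [LiePAlgebra p K L] (b : Module.Basis I K L) (w : List I) :
    RestrictedEnvelopingAlgebra p K L :=
  (w.map fun i => ι p K (b i)).prod

@[simp] theorem monomial_nil (b : Module.Basis I K L) : monomial p b [] = 1 := rfl

@[simp] theorem monomial_cons (b : Module.Basis I K L) (i : I) (w : List I) :
    monomial p b (i :: w) = ι p K (b i) * monomial p b w := by simp [monomial]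

@[simp] theorem monomial_append (b : Module.Basis I K L) (v w : List I) :
    monomial p b (v ++ w) = monomial p b v * monomial p b w := by simp [monomial]

/-- The presentation of `u(L)` as a quotient of the free algebra on a basis of `L`. -/
def ofFree (p : ℕ) [LiePAlgebra p K L] (b : Module.Basis I K L) :
    FreeAlgebra K I →ₐ[K] RestrictedEnvelopingAlgebra p K L :=
  FreeAlgebra.lift K fun i => ι p K (b i)

theorem ofFree_freeWord (b : Module.Basis I K L) (w : List I) :
    ofFree p b (freeWord K w) = monomial p b w := by
  induction w with
  | nil => simp
  | cons i w ih =>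
    rw [freeWord_cons, map_mul, ih, monomial_cons]
    simp [ofFree]

theorem ofFree_letters (b : Module.Basis I K L) (x : L) :
    ofFree p b (letters b x) = ι p K x := by
  have : (ofFree p b).toLinearMap ∘ₗ letters b = ι p K := b.ext fun i => by simp [ofFree]
  exact LinearMap.congr_fun this x

theorem ofFree_surjective (b : Module.Basis I K L) : Function.Surjective (ofFree p b) := by
  rw [← AlgHom.range_eq_top, eq_top_iff]
  have h : (AlgHom.id K (RestrictedEnvelopingAlgebra p K L)) = (ofFree p b).range.val.comp
      (RestrictedEnvelopingAlgebra.lift ((ι p K).codRestrict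
        (Subalgebra.toSubmodule (ofFree p b).range) (fun x => ⟨_, ofFree_letters b x⟩))
      (fun x y => Subtype.ext (RestrictedEnvelopingAlgebra.ι_lie p K x y))
      (fun x => Subtype.ext (RestrictedEnvelopingAlgebra.ι_pMap p K x))) := by
    apply RestrictedEnvelopingAlgebra.algHom_ext'
    intro x
    rw [AlgHom.comp_apply]
    erw [RestrictedEnvelopingAlgebra.lift_ι]
    rfl
  intro x _
  have hx := DFunLike.congr_fun h x
  rw [AlgHom.id_apply] at hx
  rw [hx]
  exact Subtype.property _

theorem span_range_monomial (b : Module.Basis I K L) :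
    Submodule.span K (Set.range (monomial p b)) = ⊤ := by
  have h := congrArg (Submodule.map (ofFree p b).toLinearMap) (freeWordBasis K I).span_eq
  rw [Submodule.map_top, LinearMap.range_eq_top.2 (ofFree_surjective b), Submodule.map_span,
    ← Set.range_comp] at h
  rw [← h]
  congr 2
  ext w
  simp [ofFree_freeWord]

variable [LinearOrder I] (b : Module.Basis I K L)

variable (p) in
/-- The action of `L` on the quotient of the free algebra by the reduction ideal. -/
def reductionRep : L →ₗ[K] Module.End K (FreeAlgebra K I ⧸ reductionIdeal p b) :=
  (Algebra.lsmul K K (FreeAlgebra K I ⧸ reductionIdeal p b)).toLinearMap ∘ₗ letters b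

theorem lsmul_eq_of_sub_mul_mem {r s : FreeAlgebra K I}
    (h : ∀ c, (r - s) * freeWord K c ∈ reductionIdeal p b) :
    Algebra.lsmul K K (FreeAlgebra K I ⧸ reductionIdeal p b) r =
      Algebra.lsmul K K (FreeAlgebra K I ⧸ reductionIdeal p b) s := by
  rw [← sub_eq_zero, ← map_sub]
  refine LinearMap.ext fun m => ?_
  obtain ⟨a, rfl⟩ := Submodule.Quotient.mk_surjective _ m
  change Submodule.Quotient.mk ((r - s) * a) = 0
  rw [Submodule.Quotient.mk_eq_zero]
  have : ⊤ ≤ ((reductionIdeal p b).restrictScalars K).comap (LinearMap.mulLeft K (r - s)) := by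
    rw [← (freeWordBasis K I).span_eq, Submodule.span_le]
    rintro _ ⟨c, rfl⟩
    rw [freeWordBasis_apply]
    exact h c
  exact this (Submodule.mem_top (x := a))

variable [hp : Fact p.Prime]

theorem ofFree_reduct {w : List I} (hw : ¬ IsRestrictedWord p w) :
    ofFree p b (reduct p b w) = monomial p b w := by
  have hp2 := hp.out.two_le
  induction w with
  | nil => exact absurd isRestrictedWord_nil hw
  | cons i v ih =>
    rw [reduct]
    split_ifs with hv
    · rcases exists_of_not_isRestrictedWord_cons hv hw with ⟨j, v, hji, rfl⟩ | ⟨v, rfl⟩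
      · rw [headReduct, if_pos hji, map_add, map_mul, ofFree_freeWord, ofFree_letters,
          ofFree_freeWord, RestrictedEnvelopingAlgebra.ι_lie]
        simp only [monomial_cons]
        noncomm_ring
      · obtain ⟨n, hn⟩ := Nat.exists_eq_add_of_le' hp2
        have hrep : ∀ m, monomial p b (List.replicate m i) = ι p K (b i) ^ m := by
          intro m; simp [monomial]
        have hpow : ι p K (b i) ^ p = ι p K (b i) * (ι p K (b i) * ι p K (b i) ^ n) := by
          rw [← pow_succ', ← pow_succ']
          exact congrArg _ hn
        rw [show p - 1 = n + 1 by omega, List.replicate_succ, List.cons_append, headReduct,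
          if_neg (lt_irrefl _), show p - 2 = n by omega, List.drop_left' (by simp), map_mul,
          ofFree_letters, ofFree_freeWord, RestrictedEnvelopingAlgebra.ι_pMap, monomial_cons,
          monomial_cons, monomial_append, hrep, hpow, mul_assoc, mul_assoc]
    · rw [map_mul, ih hv, monomial_cons]
      simp [ofFree]

/-- Every monomial is a combination of normal monomials which are not longer. -/
theorem monomial_mem_span [WellFoundedLT I] (w : List I) : monomial p b w ∈ Submodule.span K
    (monomial p b '' {v | IsRestrictedWord p v ∧ v.length ≤ w.length}) := by
  induction w using (Shortlex.wf (r := ((· < ·) : I → I → Prop)) wellFounded_lt).induction with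
  | h w ih =>
  by_cases hw : IsRestrictedWord p w
  · exact Submodule.subset_span ⟨w, ⟨hw, le_rfl⟩, rfl⟩
  rw [← ofFree_reduct b hw]
  refine (Submodule.span_le (p := (Submodule.span K (monomial p b ''
    {v | IsRestrictedWord p v ∧ v.length ≤ w.length})).comap (ofFree p b).toLinearMap)).2 ?_
    (reduct_mem p b hw)
  rintro _ ⟨v, hv, rfl⟩
  have hlen : v.length ≤ w.length := by
    rcases List.shortlex_def.1 hv with h | h
    exacts [h.le, h.1.le]
  rw [SetLike.mem_coe, Submodule.mem_comap, AlgHom.toLinearMap_apply, ofFree_freeWord]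
  refine Submodule.span_mono ?_ (ih v hv)
  exact Set.image_mono fun v' hv' => ⟨hv'.1, hv'.2.trans hlen⟩

/-- A combination of normal words in the reduction ideal vanishes: a combination of the elements
`w - reduct w` involves the shortlex-largest such `w`, which is not in normal form. -/
theorem eq_zero_of_mem_reductionIdeal [WellFoundedLT I] {x : FreeAlgebra K I}
    (hx : x ∈ Submodule.span K (freeWord K '' {w | IsRestrictedWord p w}))
    (hx' : x ∈ reductionIdeal p b) : x = 0 := by
  set B := freeWordBasis K I with hB
  have hcoord : ∀ w v, w ≠ v → B.coord w (freeWord K v) = 0 := fun w v hwv => by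
    rw [← freeWordBasis_apply, Module.Basis.coord_apply, Module.Basis.repr_self,
      Finsupp.single_eq_of_ne hwv]
  have hcoord1 : ∀ w, B.coord w (freeWord K w) = 1 := fun w => by
    rw [← freeWordBasis_apply, Module.Basis.coord_apply, Module.Basis.repr_self,
      Finsupp.single_eq_same]
  rw [mem_reductionIdeal_iff, Finsupp.mem_span_image_iff_linearCombination] at hx'
  obtain ⟨d, hd, rfl⟩ := hx'
  by_cases hd0 : d = 0
  · simp [hd0]
  exfalso
  have hwf : IsWellFounded (List I) (Shortlex (· < ·)) := ⟨Shortlex.wf wellFounded_lt⟩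
  obtain ⟨w, hw, hmax⟩ := Finset.exists_max_image d.support
    (IsWellFounded.rank (Shortlex ((· < ·) : I → I → Prop))) (Finsupp.support_nonempty_iff.2 hd0)
  have hwn : ¬ IsRestrictedWord p w := hd hw
  have h1 : B.coord w (Finsupp.linearCombination K (fun w => freeWord K w - reduct p b w) d) =
      0 := by
    refine (Submodule.span_le (p := LinearMap.ker (B.coord w))).2 ?_ hx
    rintro _ ⟨v, hv, rfl⟩
    exact hcoord w v (fun h => hwn (h ▸ hv))
  have hred : ∀ v ∈ d.support, B.coord w (reduct p b v) = 0 := by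
    intro v hv
    refine (Submodule.span_le (p := LinearMap.ker (B.coord w))).2 ?_ (reduct_mem p b (hd hv))
    rintro _ ⟨v', hv', rfl⟩
    refine hcoord w v' ?_
    rintro rfl
    exact absurd (IsWellFounded.rank_lt_of_rel (r := Shortlex (· < ·)) hv') (not_lt.2 (hmax v hv))
  rw [Finsupp.linearCombination_apply, Finsupp.sum, map_sum,
    Finset.sum_eq_single_of_mem w hw] at h1
  · rw [map_smul, map_sub, hred w hw, hcoord1, sub_zero, smul_eq_mul, mul_one] at h1
    exact Finsupp.mem_support_iff.1 hw h1
  · intro v hv hvw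
    rw [map_smul, map_sub, hred v hv, hcoord w v hvw.symm, sub_zero, smul_zero]

variable [CharP K p] [WellFoundedLT I]

theorem reductionRep_lie (x y : L) : reductionRep p b ⁅x, y⁆ =
    reductionRep p b x * reductionRep p b y - reductionRep p b y * reductionRep p b x := by
  have := lsmul_eq_of_sub_mul_mem b (p := p) fun c => commutatorsReduce_of_relationsReduce
      (fun w _ => relationsReduce w) c le_rfl x y
  rw [map_sub, map_mul, map_mul] at this
  exact this.symm

theorem reductionRep_pMap (x : L) :
    reductionRep p b (LiePAlgebra.pMap p K x) = reductionRep p b x ^ p := by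
  refine map_pMap_of_basis (p := p) (K := K)
    (A := Module.End K (FreeAlgebra K I ⧸ reductionIdeal p b)) b (reductionRep p b)
    (fun x y => reductionRep_lie b x y) (fun i => ?_) x
  have := lsmul_eq_of_sub_mul_mem b fun c => (relationsReduce (b := b) (p := p) _).2 i c rfl
  rw [map_pow, ← letters_basis b i] at this
  exact this.symm

variable (p) in
/-- The representation of `u(L)` on the quotient of the free algebra by the reduction ideal. -/
def reductionAction : RestrictedEnvelopingAlgebra p K L →ₐ[K]
    Module.End K (FreeAlgebra K I ⧸ reductionIdeal p b) :=
  RestrictedEnvelopingAlgebra.lift (reductionRep p b) (reductionRep_lie b) (reductionRep_pMap b)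

theorem reductionAction_ofFree (a : FreeAlgebra K I) : reductionAction p b (ofFree p b a) =
    Algebra.lsmul K K (FreeAlgebra K I ⧸ reductionIdeal p b) a := by
  have : (reductionAction p b).comp (ofFree p b) =
      Algebra.lsmul K K (FreeAlgebra K I ⧸ reductionIdeal p b) := by
    apply FreeAlgebra.hom_ext
    funext i
    have h : ofFree p b (FreeAlgebra.ι K i) = ι p K (b i) := by simp [ofFree]
    change reductionAction p b (ofFree p b (FreeAlgebra.ι K i)) = _
    rw [h, reductionAction, RestrictedEnvelopingAlgebra.lift_ι, reductionRep,
      LinearMap.comp_apply, letters_basis]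
    rfl
  exact DFunLike.congr_fun this a

theorem linearIndependent_monomial :
    LinearIndependent K fun w : {w : List I // IsRestrictedWord p w} => monomial p b w := by
  rw [linearIndependent_iff]
  intro c hc
  set x := Finsupp.linearCombination K
    (fun w : {w : List I // IsRestrictedWord p w} => freeWord K (w : List I)) c with hx
  have hmap : ofFree p b x = 0 := by
    rw [← hc, hx, ← AlgHom.toLinearMap_apply, Finsupp.apply_linearCombination]
    congr 2
    ext w
    simp [ofFree_freeWord]
  have h0 : x = 0 := by
    refine eq_zero_of_mem_reductionIdeal (p := p) b ?_ ?_
    · rw [hx, Finsupp.linearCombination_apply]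
      exact Submodule.sum_mem _ fun w _ =>
        Submodule.smul_mem _ _ (Submodule.subset_span ⟨w, w.2, rfl⟩)
    · have h2 := reductionAction_ofFree b x
      rw [hmap, map_zero] at h2
      have h3 := LinearMap.congr_fun h2.symm (Submodule.Quotient.mk 1)
      change Submodule.Quotient.mk (x * 1) = 0 at h3
      rwa [Submodule.Quotient.mk_eq_zero, mul_one] at h3
  have hli : LinearIndependent K
      (fun w : {w : List I // IsRestrictedWord p w} => freeWord K (w : List I)) := by
    have := (freeWordBasis K I).linearIndependent.comp
      (Subtype.val : {w : List I // IsRestrictedWord p w} → List I) Subtype.val_injective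
    convert this using 1
    ext w
    simp
  exact linearIndependent_iff.1 hli c h0

variable (p) in
/-- The Poincaré–Birkhoff–Witt theorem for restricted enveloping algebras: the normal monomials in
a well-ordered basis of `L` form a basis of `u(L)`. -/
def pbwBasis : Module.Basis {w : List I // IsRestrictedWord p w} K
    (RestrictedEnvelopingAlgebra p K L) :=
  Module.Basis.mk (linearIndependent_monomial b) (by
    rw [← span_range_monomial b, Submodule.span_le]
    rintro _ ⟨w, rfl⟩
    refine Submodule.span_mono ?_ (monomial_mem_span b w)
    rintro _ ⟨v, hv, rfl⟩
    exact ⟨⟨v, hv.1⟩, rfl⟩)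

@[simp] theorem pbwBasis_apply (w : {w : List I // IsRestrictedWord p w}) :
    pbwBasis p b w = monomial p b (w : List I) := by simp [pbwBasis]

end PBW
end

noncomputable section

/-! ### Finite projective dimension and Frobenius algebras -/

section Projective

open CategoryTheory

universe w

theorem projective_of_isScalarTower {R T P : Type*} [Ring R] [Ring T] [AddCommGroup P] [Module R T]
    [Module T P] [Module R P] [IsScalarTower R T T] [IsScalarTower R T P] [Module.Projective R T]
    [hP : Module.Projective T P] : Module.Projective R P := by
  obtain ⟨s, hs⟩ := Module.projective_def'.1 hP
  have : Module.Projective R (P →₀ T) := by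
    classical
    exact Module.Projective.of_equiv (finsuppLequivDFinsupp (ι := P) (M := T) R).symm
  refine Module.Projective.of_split (s.restrictScalars R)
    ((Finsupp.linearCombination T id).restrictScalars R) ?_
  ext x
  exact LinearMap.congr_fun hs x

theorem projective_of_exact_of_leftInverse {R M N P : Type*} [Ring R] [AddCommGroup M]
    [AddCommGroup N] [AddCommGroup P] [Module R M] [Module R N] [Module R P]
    [Module.Projective R N] {f : M →ₗ[R] N} {g : N →ₗ[R] P} (hfg : Function.Exact f g)
    (hg : Function.Surjective g) {l : N →ₗ[R] M} (hl : l ∘ₗ f = LinearMap.id) :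
    Module.Projective R P := by
  have h : Function.Surjective g ∧ ∃ l, l ∘ₗ f = LinearMap.id := ⟨hg, l, hl⟩
  obtain ⟨-, σ, hσ⟩ := (hfg.split_tfae'.out 1 0 rfl rfl).1 h
  exact Module.Projective.of_split σ g hσ

/-- Let `R → T` be a ring homomorphism such that `T` is projective over `R`. If projective
`R`-modules are injective, then a `T`-module of finite projective dimension is projective
over `R`. -/
theorem projective_of_hasProjectiveDimensionLE {R T : Type w} [Ring R] [Ring T] [Module R T]
    [IsScalarTower R T T] [Module.Projective R T]
    (hinj : ∀ (Y P : Type w) [AddCommGroup Y] [Module R Y] [AddCommGroup P] [Module R P]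
      [Module.Projective R Y] (f : Y →ₗ[R] P), Function.Injective f →
        ∃ g : P →ₗ[R] Y, g ∘ₗ f = LinearMap.id)
    (n : ℕ) (X : Type w) [AddCommGroup X] [Module T X] [Module R X] [IsScalarTower R T X]
    (hX : HasProjectiveDimensionLE (ModuleCat.of T X) n) : Module.Projective R X := by
  induction n generalizing X with
  | zero =>
    rw [← projective_iff_hasProjectiveDimensionLE_zero, ← IsProjective.iff_projective] at hX
    exact projective_of_isScalarTower (T := T)
  | succ n ih =>
    -- Present `X` by a free module; the kernel has smaller projective dimension.
    let g : (X →₀ T) →ₗ[T] X := Finsupp.linearCombination T id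
    have hg : Function.Surjective g := fun x => ⟨Finsupp.single x 1, by simp [g]⟩
    have hS := g.shortExact_shortComplexKer hg
    have hfree : Projective (ModuleCat.of T (X →₀ T)) :=
      (IsProjective.iff_projective _).1 inferInstance
    have hker := ih (LinearMap.ker g) ((hS.hasProjectiveDimensionLT_X₃_iff n hfree).1 hX)
    let f : LinearMap.ker g →ₗ[R] (X →₀ T) := (LinearMap.ker g).subtype.restrictScalars R
    obtain ⟨l, hl⟩ := hinj (LinearMap.ker g) (X →₀ T) f Subtype.val_injective
    have : Module.Projective R (X →₀ T) := projective_of_isScalarTower (T := T)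
    have hexact : Function.Exact f (g.restrictScalars R) := fun x => by simp [f]
    exact projective_of_exact_of_leftInverse (M := LinearMap.ker g) (N := X →₀ T) (P := X)
      hexact hg hl

/-- Over a finite-dimensional algebra with a nondegenerate linear form (a Frobenius algebra),
projective modules are injective. -/
theorem exists_leftInverse_of_frobenius {K : Type*} {R Y P : Type*} [Field K] [Ring R] [Algebra K R]
    [FiniteDimensional K R] (φ : R →ₗ[K] K) (hφ : ∀ b : R, b ≠ 0 → ∃ a, φ (a * b) ≠ 0)
    [AddCommGroup Y] [Module R Y] [AddCommGroup P] [Module R P] [hY : Module.Projective R Y]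
    (f : Y →ₗ[R] P) (hf : Function.Injective f) : ∃ g : P →ₗ[R] Y, g ∘ₗ f = LinearMap.id := by
  let : Module K Y := Module.compHom Y (algebraMap K R)
  let : Module K P := Module.compHom P (algebraMap K R)
  have : IsScalarTower K R Y := ⟨fun c r y => by
    rw [Algebra.smul_def, mul_smul]; rfl⟩
  have : IsScalarTower K R P := ⟨fun c r y => by
    rw [Algebra.smul_def, mul_smul]; rfl⟩
  let Φ : (Y →₀ R) →ₗ[K] (Y →₀ K) := Finsupp.mapRange.linearMap φ
  have hΦ : ∀ z y, Φ z y = φ (z y) := fun z y => by simp [Φ]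
  have huniq : ∀ z z' : Y →₀ R, (∀ r : R, Φ (r • z) = Φ (r • z')) → z = z' := by
    intro z z' h
    ext y
    by_contra hne
    obtain ⟨a, ha⟩ := hφ _ (sub_ne_zero.2 hne)
    refine ha ?_
    have := DFunLike.congr_fun (h a) y
    rw [hΦ, hΦ, Finsupp.smul_apply, Finsupp.smul_apply, smul_eq_mul, smul_eq_mul] at this
    rw [mul_sub, map_sub, this, sub_self]
  -- The form identifies `R` with its dual, so that free modules are coinduced from `K`.
  have hsurj : ∀ ψ : R →ₗ[K] K, ∃ c : R, ∀ r, φ (r * c) = ψ r := by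
    let D : R →ₗ[K] Module.Dual K R := ((LinearMap.mul K R).compr₂ φ).flip
    have hD : ∀ c r, D c r = φ (r * c) := fun c r => rfl
    have hinj : Function.Injective D := by
      rw [← LinearMap.ker_eq_bot, LinearMap.ker_eq_bot']
      intro c hc
      by_contra hne
      obtain ⟨a, ha⟩ := hφ c hne
      exact ha (by rw [← hD, hc, LinearMap.zero_apply])
    intro ψ
    obtain ⟨c, hc⟩ := (LinearMap.injective_iff_surjective_of_finrank_eq_finrank
      Subspace.dual_finrank_eq.symm).1 hinj ψ
    exact ⟨c, fun r => by rw [← hD, hc]⟩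
  have hex : ∀ q : R →ₗ[K] (Y →₀ K), ∃ z : Y →₀ R, ∀ r : R, Φ (r • z) = q r := by
    intro q
    let B := Module.finBasis K R
    choose c hc using fun k => hsurj (B.coord k)
    refine ⟨∑ k, Finsupp.mapRange.linearMap (LinearMap.toSpanSingleton K R (c k)) (q (B k)),
      fun r => ?_⟩
    ext y
    rw [hΦ, Finsupp.smul_apply, Finsupp.finsetSum_apply, smul_eq_mul, Finset.mul_sum, map_sum]
    conv_rhs => rw [← B.sum_repr r, map_sum, Finsupp.finsetSum_apply]
    refine Finset.sum_congr rfl fun k _ => ?_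
    simp [hc, mul_comm]
  obtain ⟨s, hs⟩ := Module.projective_def'.1 hY
  obtain ⟨h, hh⟩ := (f.restrictScalars K).exists_leftInverse_of_injective
    (LinearMap.ker_eq_bot.2 hf)
  let q : P →ₗ[K] (Y →₀ K) := (Φ ∘ₗ s.restrictScalars K) ∘ₗ h
  have hq : ∀ y, q (f y) = Φ (s y) := fun y => by
    have : h (f y) = y := LinearMap.congr_fun hh y
    simp [q, this]
  choose z hz using fun m : P => hex (q ∘ₗ (LinearMap.toSpanSingleton R P m).restrictScalars K)
  have hz' : ∀ (m : P) (r : R), Φ (r • z m) = q (r • m) := fun m r => by simp [hz]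
  let G : P →ₗ[R] (Y →₀ R) :=
    { toFun := z
      map_add' := fun m m' => huniq _ _ fun r => by
        rw [hz', smul_add, map_add, smul_add, map_add, hz', hz']
      map_smul' := fun a m => huniq _ _ fun r => by
        rw [hz', RingHom.id_apply, smul_smul, smul_smul, hz'] }
  refine ⟨Finsupp.linearCombination R id ∘ₗ G, ?_⟩
  ext y
  have hG : G (f y) = s y := huniq _ _ fun r => by
    change Φ (r • z (f y)) = _
    rw [hz', ← map_smul, hq, map_smul]
  rw [LinearMap.comp_apply, LinearMap.comp_apply, hG]
  exact LinearMap.congr_fun hs y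

end Projective
end

noncomputable section

/-! ### Freeness over the restricted enveloping algebra of a subalgebra -/

theorem wellFoundedLT_sumLex (α β : Type*) [LinearOrder α] [LinearOrder β] [WellFoundedLT α]
    [WellFoundedLT β] : WellFoundedLT (α ⊕ₗ β) :=
  ⟨Sum.lex_wf wellFounded_lt wellFounded_lt⟩

section Join

variable {α β : Type*}

/-- The concatenation of a word in `α` and a word in `β`, as a word in their lexicographic sum. -/
def joinWords (v : List α) (w : List β) : List (α ⊕ₗ β) :=
  v.map (fun a => toLex (Sum.inl a)) ++ w.map (fun a => toLex (Sum.inr a))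

theorem joinWords_injective {v v' : List α} {w w' : List β}
    (h : joinWords v w = joinWords v' w') : v = v' ∧ w = w' := by
  have h1 : ∀ (v : List α) (w : List β),
      (joinWords v w).filterMap (fun x => (ofLex x).getLeft?) = v := by
    intro v w
    simp [joinWords, List.filterMap_append, List.filterMap_map, Function.comp_def]
  have h2 : ∀ (v : List α) (w : List β),
      (joinWords v w).filterMap (fun x => (ofLex x).getRight?) = w := by
    intro v w
    simp [joinWords, List.filterMap_append, List.filterMap_map, Function.comp_def]
  exact ⟨by rw [← h1 v w, h, h1], by rw [← h2 v w, h, h2]⟩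

variable [LinearOrder α] [LinearOrder β]

theorem isRestrictedWord_map_append_map {γ : Type*} [LinearOrder γ] {p : ℕ} (f : α → γ) (g : β → γ)
    (hf : ∀ a a', f a ≤ f a' ↔ a ≤ a') (hg : ∀ c c', g c ≤ g c' ↔ c ≤ c')
    (hfg : ∀ a c, f a < g c) (hγ : ∀ x, (∃ a, f a = x) ∨ ∃ c, g c = x) {v : List α} {w : List β} :
    IsRestrictedWord p (v.map f ++ w.map g) ↔ IsRestrictedWord p v ∧ IsRestrictedWord p w := by
  have hl : ∀ i, (v.map f ++ w.map g).count (f i) = v.count i := fun i => by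
    rw [List.count_append, List.count_eq_zero_of_not_mem (l := List.map _ w), add_zero,
      List.count_map_of_injective v f fun a a' h =>
        le_antisymm ((hf _ _).1 h.le) ((hf _ _).1 h.ge)]
    simpa using fun c _ => (hfg i c).ne'
  have hr : ∀ i, (v.map f ++ w.map g).count (g i) = w.count i := fun i => by
    rw [List.count_append, List.count_eq_zero_of_not_mem (l := List.map _ v), zero_add,
      List.count_map_of_injective w g fun a a' h =>
        le_antisymm ((hg _ _).1 h.le) ((hg _ _).1 h.ge)]
    simpa using fun a _ => (hfg a i).ne
  have hs : (v.map f ++ w.map g).Pairwise (· ≤ ·) ↔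
      v.Pairwise (· ≤ ·) ∧ w.Pairwise (· ≤ ·) := by
    rw [List.pairwise_append, List.pairwise_map, List.pairwise_map]
    simp only [hf, hg, List.mem_map]
    refine and_congr_right fun _ => and_iff_left ?_
    rintro _ ⟨a, -, rfl⟩ _ ⟨c, -, rfl⟩
    exact (hfg a c).le
  constructor
  · rintro ⟨h1, h2⟩
    rw [hs] at h1
    exact ⟨⟨h1.1, fun i => hl i ▸ h2 _⟩, ⟨h1.2, fun i => hr i ▸ h2 _⟩⟩
  · rintro ⟨⟨h1, h2⟩, ⟨h3, h4⟩⟩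
    refine ⟨hs.2 ⟨h1, h3⟩, fun i => ?_⟩
    rcases hγ i with ⟨i, rfl⟩ | ⟨i, rfl⟩
    · exact (hl i).trans_lt (h2 i)
    · exact (hr i).trans_lt (h4 i)

theorem isRestrictedWord_joinWords {p : ℕ} {v : List α} {w : List β} :
    IsRestrictedWord p (joinWords v w) ↔ IsRestrictedWord p v ∧ IsRestrictedWord p w := by
  refine isRestrictedWord_map_append_map _ _ (fun _ _ => Sum.Lex.inl_le_inl_iff)
    (fun _ _ => Sum.Lex.inr_le_inr_iff) (fun _ _ => Sum.Lex.inl_lt_inr _ _) fun x => ?_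
  obtain ⟨x | x, rfl⟩ := toLex.surjective x
  exacts [.inl ⟨x, rfl⟩, .inr ⟨x, rfl⟩]

theorem exists_joinWords_eq {u : List (α ⊕ₗ β)} (hu : u.Pairwise (· ≤ ·)) :
    ∃ v w, joinWords v w = u := by
  induction u with
  | nil => exact ⟨[], [], rfl⟩
  | cons i u ih =>
    rw [List.pairwise_cons] at hu
    obtain ⟨v, w, rfl⟩ := ih hu.2
    obtain ⟨i | i, rfl⟩ := toLex.surjective i
    · exact ⟨i :: v, w, by simp [joinWords]⟩
    · cases v with
      | nil => exact ⟨[], i :: w, by simp [joinWords]⟩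
      | cons j v =>
        have := hu.1 (toLex (Sum.inl j)) (by simp [joinWords])
        exact absurd this Sum.Lex.not_inr_le_inl

variable (α β) in
/-- A normal word in `α ⊕ₗ β` is a normal word in `α` followed by a normal word in `β`. -/
def joinEquiv (p : ℕ) :
    {v : List α // IsRestrictedWord p v} × {w : List β // IsRestrictedWord p w} ≃
      {u : List (α ⊕ₗ β) // IsRestrictedWord p u} :=
  Equiv.ofBijective
    (fun x => ⟨joinWords x.1.1 x.2.1, isRestrictedWord_joinWords.2 ⟨x.1.2, x.2.2⟩⟩) (by
    constructor
    · rintro ⟨⟨v, hv⟩, ⟨w, hw⟩⟩ ⟨⟨v', hv'⟩, ⟨w', hw'⟩⟩ h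
      obtain ⟨rfl, rfl⟩ := joinWords_injective (congrArg Subtype.val h)
      rfl
    · rintro ⟨u, hu⟩
      obtain ⟨v, w, rfl⟩ := exists_joinWords_eq hu.1
      obtain ⟨hv, hw⟩ := isRestrictedWord_joinWords.1 hu
      exact ⟨⟨⟨v, hv⟩, ⟨w, hw⟩⟩, rfl⟩)

end Join

section Free

open RestrictedEnvelopingAlgebra (ι)
open MulOpposite (op unop)

variable {p : ℕ} {K : Type*} {S L : Type*} [Field K] [LieRing S]
  [LieAlgebra K S] [LiePAlgebra p K S] [LieRing L] [LieAlgebra K L] [LiePAlgebra p K L]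

variable (p K S L) in
/-- A homomorphism of Lie `p`-algebras. -/
structure LiePHom extends S →ₗ⁅K⁆ L where
  map_pMap' : ∀ x : S, toLieHom (LiePAlgebra.pMap p K x) = LiePAlgebra.pMap p K (toLieHom x)

namespace RestrictedEnvelopingAlgebra

/-- The homomorphism `u(S) → u(L)` induced by a homomorphism of Lie `p`-algebras. -/
def map (f : LiePHom p K S L) :
    RestrictedEnvelopingAlgebra p K S →ₐ[K] RestrictedEnvelopingAlgebra p K L :=
  lift (ι p K ∘ₗ (f.toLieHom : S →ₗ[K] L))
    (fun x y => by simpa using ι_lie p K (f.toLieHom x) (f.toLieHom y))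
    (fun x => by
      have := f.map_pMap' x
      simp only [LinearMap.comp_apply, LieHom.coe_toLinearMap, this, ι_pMap])

@[simp] theorem map_ι (f : LiePHom p K S L) (x : S) : map f (ι p K x) = ι p K (f.toLieHom x) := by
  simp [map]

theorem augmentation_map [Fact p.Prime] (f : LiePHom p K S L)
    (a : RestrictedEnvelopingAlgebra p K S) :
    augmentation p K L (map f a) = augmentation p K S a := by
  have : (augmentation p K L).comp (map f) = augmentation p K S :=
    algHom_ext' fun x => by simp
  exact DFunLike.congr_fun this a

end RestrictedEnvelopingAlgebra

/-- A basis of a subspace extends to a basis indexed by a lexicographic sum. -/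
theorem exists_basis_sumLex {K S L J : Type*} [Field K] [AddCommGroup S] [Module K S]
    [AddCommGroup L] [Module K L] (f : S →ₗ[K] L) (hf : Function.Injective f)
    (bS : Module.Basis J K S) : ∃ (I : Set L) (b : Module.Basis (I ⊕ₗ J) K L),
      ∀ j, b (toLex (Sum.inr j)) = f (bS j) := by
  obtain ⟨Q, hQ⟩ := (LinearMap.range f).exists_isCompl
  let bQ := Module.Basis.ofVectorSpace K Q
  let b := ((bQ.prod (bS.map (LinearEquiv.ofInjective f hf))).map
    (Submodule.prodEquivOfIsCompl Q _ hQ.symm))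
  have hinj : Function.Injective fun i : Module.Basis.ofVectorSpaceIndex K Q => ((i : Q) : L) :=
    Subtype.val_injective.comp Subtype.val_injective
  let e := Equiv.ofInjective _ hinj
  refine ⟨_, b.reindex ((Equiv.sumCongr e (Equiv.refl J)).trans toLex), fun j => ?_⟩
  simp [b]

variable [Fact p.Prime] [CharP K p]

/-- `u(L)` is a free right module over `u(S)` for a `p`-subalgebra `S` of `L`. -/
theorem free_of_injective (f : LiePHom p K S L) (hf : Function.Injective f.toLieHom) :
    letI := Module.compHom (RestrictedEnvelopingAlgebra p K L)ᵐᵒᵖ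
      (RestrictedEnvelopingAlgebra.map f).toRingHom.op
    Module.Free (RestrictedEnvelopingAlgebra p K S)ᵐᵒᵖ (RestrictedEnvelopingAlgebra p K L)ᵐᵒᵖ := by
  let bS := Module.Basis.ofVectorSpace K S
  obtain ⟨I, b, hb⟩ := exists_basis_sumLex (f.toLieHom : S →ₗ[K] L) hf bS
  obtain ⟨_, _⟩ := exists_wellFoundedLT I
  obtain ⟨_, _⟩ := exists_wellFoundedLT (Module.Basis.ofVectorSpaceIndex K S)
  have := wellFoundedLT_sumLex I (Module.Basis.ofVectorSpaceIndex K S)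
  let : Module (RestrictedEnvelopingAlgebra p K S)ᵐᵒᵖ (RestrictedEnvelopingAlgebra p K L)ᵐᵒᵖ :=
    Module.compHom _ (RestrictedEnvelopingAlgebra.map f).toRingHom.op
  have hsmul : ∀ (r : (RestrictedEnvelopingAlgebra p K S)ᵐᵒᵖ)
      (t : (RestrictedEnvelopingAlgebra p K L)ᵐᵒᵖ),
      r • t = op (unop t * RestrictedEnvelopingAlgebra.map f (unop r)) := fun _ _ => rfl
  have : IsScalarTower K (RestrictedEnvelopingAlgebra p K S)ᵐᵒᵖ
      (RestrictedEnvelopingAlgebra p K L)ᵐᵒᵖ := ⟨fun c r t => by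
    rw [hsmul, hsmul, MulOpposite.unop_smul, map_smul, mul_smul_comm, MulOpposite.op_smul]⟩
  let m : {v : List I // IsRestrictedWord p v} → (RestrictedEnvelopingAlgebra p K L)ᵐᵒᵖ :=
    fun v => op (monomial p b (joinWords v.1 []))
  let F := Finsupp.linearCombination (RestrictedEnvelopingAlgebra p K S)ᵐᵒᵖ m
  let B₁ := Finsupp.basis (ι := {v : List I // IsRestrictedWord p v})
    fun _ => (pbwBasis p bS).map (MulOpposite.opLinearEquiv K)
  let B₂ := (pbwBasis p b).map (MulOpposite.opLinearEquiv K)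
  let E := B₁.equiv B₂ ((Equiv.sigmaEquivProd _ _).trans (joinEquiv I _ p))
  have hFE : F.restrictScalars K = E.toLinearMap := by
    refine B₁.ext fun ⟨v, w⟩ => ?_
    have hmap : RestrictedEnvelopingAlgebra.map f (monomial p bS w.1) =
        monomial p b (joinWords [] w.1) := by
      rw [monomial, map_list_prod, monomial, joinWords, List.map_nil, List.nil_append,
        List.map_map, List.map_map]
      congr 1
      refine List.map_congr_left fun j _ => ?_
      simp [hb]
    have hE : E (B₁ ⟨v, w⟩) = op (monomial p b (joinWords v.1 w.1)) := by
      simp only [E, Module.Basis.equiv_apply]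
      simp only [B₂, Module.Basis.map_apply, pbwBasis_apply]
      rfl
    have hB : B₁ ⟨v, w⟩ = Finsupp.single v (op (monomial p bS w.1)) := by
      simp [B₁]
    rw [LinearEquiv.coe_coe, hE, hB, LinearMap.restrictScalars_apply,
      Finsupp.linearCombination_single, hsmul, MulOpposite.unop_op, MulOpposite.unop_op, hmap,
      ← monomial_append]
    simp [joinWords]
  have hbij : Function.Bijective F := by
    have : (F : _ → _) = E := by
      funext x
      exact LinearMap.congr_fun hFE x
    rw [this]
    exact E.bijective
  exact Module.Free.of_equiv (LinearEquiv.ofBijective F hbij)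

end Free
end

noncomputable section

/-! ### The Frobenius form of a finite-dimensional restricted enveloping algebra -/

section Frobenius

open RestrictedEnvelopingAlgebra (ι)

variable {p : ℕ} {K : Type*} {L J : Type*} [Field K] [LieRing L]
  [LieAlgebra K L] [LiePAlgebra p K L]

/-- The span of the products of fewer than `d` basis elements. -/
def lowDegree (p : ℕ) [LiePAlgebra p K L] (b : Module.Basis J K L) (d : ℕ) :
    Submodule K (RestrictedEnvelopingAlgebra p K L) :=
  Submodule.span K (monomial p b '' {w | w.length < d})

theorem ι_basis_mul_mem_lowDegree (b : Module.Basis J K L) {d : ℕ}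
    {a : RestrictedEnvelopingAlgebra p K L} (ha : a ∈ lowDegree p b d) (i : J) :
    ι p K (b i) * a ∈ lowDegree p b (d + 1) := by
  have : lowDegree p b d ≤
      (lowDegree p b (d + 1)).comap (LinearMap.mulLeft K (ι p K (b i))) := by
    rw [lowDegree, Submodule.span_le]
    rintro _ ⟨w, hw, rfl⟩
    refine Submodule.subset_span ⟨i :: w, ?_, by simp⟩
    simpa using hw
  exact this ha

theorem ι_mul_mem_lowDegree (b : Module.Basis J K L) {d : ℕ}
    {a : RestrictedEnvelopingAlgebra p K L} (ha : a ∈ lowDegree p b d) (x : L) :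
    ι p K x * a ∈ lowDegree p b (d + 1) := by
  induction b.mem_span x using Submodule.span_induction with
  | mem _ h =>
    obtain ⟨i, rfl⟩ := h
    exact ι_basis_mul_mem_lowDegree b ha i
  | zero => simp
  | add x y _ _ hx hy =>
    rw [map_add, add_mul]
    exact add_mem hx hy
  | smul c x _ hx =>
    rw [map_smul, smul_mul_assoc]
    exact Submodule.smul_mem _ _ hx

theorem monomial_mem_lowDegree (b : Module.Basis J K L) {w : List J} {d : ℕ} (h : w.length < d) :
    monomial p b w ∈ lowDegree p b d := Submodule.subset_span ⟨w, h, rfl⟩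

/-- The graded algebra of `u(L)` is commutative. -/
theorem monomial_sub_mem_lowDegree_of_perm (b : Module.Basis J K L) {v w : List J}
    (h : v.Perm w) : monomial p b v - monomial p b w ∈ lowDegree p b v.length := by
  induction h with
  | nil => simp
  | cons i _ ih =>
    rw [monomial_cons, monomial_cons, ← mul_sub]
    exact ι_basis_mul_mem_lowDegree b ih i
  | swap i j l =>
    simp only [monomial_cons, ← mul_assoc, ← sub_mul, ← RestrictedEnvelopingAlgebra.ι_lie]
    exact ι_mul_mem_lowDegree b (monomial_mem_lowDegree b (Nat.lt_succ_self _)) _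
  | trans h₁ _ ih₁ ih₂ =>
    rw [← h₁.length_eq] at ih₂
    simpa using add_mem ih₁ ih₂

theorem monomial_mem_lowDegree_of_le_count [hp : Fact p.Prime] [DecidableEq J]
    (b : Module.Basis J K L) {w : List J}
    {i : J} (h : p ≤ w.count i) : monomial p b w ∈ lowDegree p b w.length := by
  obtain ⟨v, hv⟩ := (List.replicate_sublist_iff.2 h).exists_perm_append
  have h1 := monomial_sub_mem_lowDegree_of_perm (p := p) b hv
  have hlen := hv.length_eq
  rw [List.length_append, List.length_replicate] at hlen
  have h2 : monomial p b (List.replicate p i ++ v) ∈ lowDegree p b w.length := by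
    have hrep : monomial p b (List.replicate p i) = ι p K (b i) ^ p := by simp [monomial]
    rw [monomial_append, hrep, ← RestrictedEnvelopingAlgebra.ι_pMap]
    have := hp.out.two_le
    obtain ⟨n, hn⟩ : ∃ n, w.length = n + 1 := ⟨w.length - 1, by omega⟩
    rw [hn]
    exact ι_mul_mem_lowDegree b
      (monomial_mem_lowDegree b (by omega)) _
  simpa using add_mem h1 h2

variable [LinearOrder J]

theorem finite_isRestrictedWord [Finite J] : Finite {w : List J // IsRestrictedWord p w} := by
  refine Finite.of_injective
    (fun w j => (⟨w.1.count j, w.2.2 j⟩ : Fin p) : _ → (J → Fin p)) fun v w h => ?_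
  refine Subtype.ext (List.Perm.eq_of_pairwise (fun _ _ _ _ => le_antisymm) v.2.1 w.2.1
    (List.perm_iff_count.2 fun j => ?_))
  exact congrArg Fin.val (congrFun h j)

variable [Fintype J]

variable (p J) in
/-- The longest word in normal form, in which each letter occurs `p - 1` times. -/
def topWord : List J := ((p - 1) • (Finset.univ : Finset J).val).sort (· ≤ ·)

theorem coe_topWord : (topWord p J : Multiset J) = (p - 1) • (Finset.univ : Finset J).val :=
  Multiset.sort_eq _ _

theorem count_topWord (j : J) : (topWord p J).count j = p - 1 := by
  rw [← Multiset.coe_count, coe_topWord, Multiset.count_nsmul,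
    Multiset.count_eq_one_of_mem Finset.univ.nodup (Finset.mem_univ j), mul_one]

theorem perm_topWord_of_count_lt {w : List J} (hc : ∀ j, w.count j < p)
    (hlen : w.length = (topWord p J).length) : w.Perm (topWord p J) := by
  rw [← Multiset.coe_eq_coe]
  refine Multiset.eq_of_le_of_card_le (Multiset.le_iff_count.2 fun j => ?_) (by simp [hlen])
  rw [Multiset.coe_count, Multiset.coe_count, count_topWord]
  have := hc j
  omega

variable [hp : Fact p.Prime]

theorem isRestrictedWord_topWord : IsRestrictedWord p (topWord p J) :=
  ⟨Multiset.pairwise_sort _ _, fun j => by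
    rw [count_topWord]; have := hp.out.pos; omega⟩

variable [CharP K p] (b : Module.Basis J K L)

variable (p) in
/-- The Frobenius form: the coefficient of the longest normal monomial. -/
def topCoeff : RestrictedEnvelopingAlgebra p K L →ₗ[K] K :=
  (pbwBasis p b).coord ⟨topWord p J, isRestrictedWord_topWord⟩

theorem topCoeff_eq_zero_of_mem_lowDegree {a : RestrictedEnvelopingAlgebra p K L}
    (ha : a ∈ lowDegree p b (topWord p J).length) : topCoeff p b a = 0 := by
  refine (Submodule.span_le (p := LinearMap.ker (topCoeff p b))).2 ?_ ha
  rintro _ ⟨w, hw, rfl⟩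
  refine (Submodule.span_le (p := LinearMap.ker (topCoeff p b))).2 ?_ (monomial_mem_span b w)
  rintro _ ⟨v, ⟨hv, hvw⟩, rfl⟩
  have hw' : w.length < (topWord p J).length := hw
  rw [SetLike.mem_coe, LinearMap.mem_ker, ← pbwBasis_apply b ⟨v, hv⟩, topCoeff,
    Module.Basis.coord_apply, Module.Basis.repr_self, Finsupp.single_eq_of_ne]
  intro h
  have h' : topWord p J = v := congrArg Subtype.val h
  rw [h'] at hw'
  exact absurd hvw (not_le.2 hw')

theorem topCoeff_monomial_of_perm {w : List J} (h : w.Perm (topWord p J)) :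
    topCoeff p b (monomial p b w) = 1 := by
  have h1 := monomial_sub_mem_lowDegree_of_perm (p := p) b h
  rw [h.length_eq] at h1
  have h2 := topCoeff_eq_zero_of_mem_lowDegree b h1
  rw [map_sub, sub_eq_zero] at h2
  rw [h2, ← pbwBasis_apply b ⟨_, isRestrictedWord_topWord⟩, topCoeff, Module.Basis.coord_apply,
    Module.Basis.repr_self, Finsupp.single_eq_same]

theorem topCoeff_monomial_of_not_perm {w : List J} (hlen : w.length ≤ (topWord p J).length)
    (h : ¬ w.Perm (topWord p J)) : topCoeff p b (monomial p b w) = 0 := by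
  apply topCoeff_eq_zero_of_mem_lowDegree
  rcases hlen.lt_or_eq with hlt | heq
  · exact monomial_mem_lowDegree b hlt
  · rw [← heq]
    have : ∃ j, p ≤ w.count j := by
      by_contra! hc
      exact h (perm_topWord_of_count_lt hc heq)
    obtain ⟨j, hj⟩ := this
    exact monomial_mem_lowDegree_of_le_count b hj

/-- The Frobenius form is nondegenerate: the complement of a longest monomial occurring in `a`
picks out its coefficient. -/
theorem exists_topCoeff_mul_ne_zero {a : RestrictedEnvelopingAlgebra p K L} (ha : a ≠ 0) :
    ∃ c, topCoeff p b (a * c) ≠ 0 := by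
  set B := pbwBasis p b with hB
  obtain ⟨v, hv, hmax⟩ := Finset.exists_max_image (B.repr a).support (fun w => w.1.length)
    (Finsupp.support_nonempty_iff.2 (by simpa using ha))
  have hle : (v.1 : Multiset J) ≤ topWord p J := Multiset.le_iff_count.2 fun j => by
    rw [Multiset.coe_count, Multiset.coe_count, count_topWord]
    have := v.2.2 j
    omega
  obtain ⟨m, hm⟩ := Multiset.le_iff_exists_add.1 hle
  obtain ⟨u, rfl⟩ := Quot.exists_rep m
  have hperm : ∀ w : List J, (w ++ u).Perm (topWord p J) ↔ w.Perm v.1 := fun w => by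
    rw [← Multiset.coe_eq_coe, hm, ← Multiset.coe_add, ← Multiset.coe_eq_coe]
    exact add_left_inj _
  have hlen := ((hperm v.1).2 (List.Perm.refl _)).length_eq
  rw [List.length_append] at hlen
  refine ⟨monomial p b u, ?_⟩
  have hsum : topCoeff p b (a * monomial p b u) =
      ∑ w ∈ (B.repr a).support, B.repr a w * topCoeff p b (monomial p b (w.1 ++ u)) := by
    conv_lhs => rw [← B.linearCombination_repr a, Finsupp.linearCombination_apply, Finsupp.sum,
      Finset.sum_mul, map_sum]
    refine Finset.sum_congr rfl fun w _ => ?_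
    rw [smul_mul_assoc, map_smul, hB, pbwBasis_apply, monomial_append, smul_eq_mul]
  rw [hsum, Finset.sum_eq_single_of_mem v hv, topCoeff_monomial_of_perm b ((hperm _).2 (.refl _)),
    mul_one]
  · exact Finsupp.mem_support_iff.1 hv
  · intro w hw hwv
    rw [topCoeff_monomial_of_not_perm b, mul_zero]
    · rw [List.length_append]
      have := hmax w hw
      omega
    · rw [hperm]
      intro h
      exact hwv (Subtype.ext (List.Perm.eq_of_pairwise (fun _ _ _ _ => le_antisymm)
        w.2.1 v.2.1 h))

end Frobenius

/-! ### The integral given by finite cohomological dimension -/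

section Integral

open CategoryTheory MulOpposite

variable {p : ℕ} [hp : Fact p.Prime] {K : Type u} {S L : Type v} [Field K] [CharP K p] [LieRing S]
  [LieAlgebra K S] [LiePAlgebra p K S] [LieRing L] [LieAlgebra K L] [LiePAlgebra p K L]

open RestrictedEnvelopingAlgebra

/-- If `cd_*(L)` is finite and `S` is a finite-dimensional `p`-subalgebra of `L`, then the trivial
`u(S)`-module is projective, so that the augmentation of `u(S)` splits: `θ` is the image of `1`
under a section. -/
theorem exists_integral (f : LiePHom p K S L) (hf : Function.Injective f.toLieHom)
    [FiniteDimensional K S] (hL : restrictedCohomologicalDimension p K L < ⊤) :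
    ∃ θ : RestrictedEnvelopingAlgebra p K S, augmentation p K S θ = 1 ∧
      ∀ a, θ * a = augmentation p K S a • θ := by
  obtain ⟨n, hn⟩ := (projectiveDimension_ne_top_iff _).1 hL.ne
  let : Module (RestrictedEnvelopingAlgebra p K S)ᵐᵒᵖ (RestrictedEnvelopingAlgebra p K L)ᵐᵒᵖ :=
    Module.compHom _ (RestrictedEnvelopingAlgebra.map f).toRingHom.op
  have : Module.Free (RestrictedEnvelopingAlgebra p K S)ᵐᵒᵖ
    (RestrictedEnvelopingAlgebra p K L)ᵐᵒᵖ := free_of_injective f hf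
  have hsmul : ∀ (r : (RestrictedEnvelopingAlgebra p K S)ᵐᵒᵖ)
      (t : (RestrictedEnvelopingAlgebra p K L)ᵐᵒᵖ),
      r • t = op (unop t * RestrictedEnvelopingAlgebra.map f (unop r)) := fun _ _ => rfl
  have : IsScalarTower (RestrictedEnvelopingAlgebra p K S)ᵐᵒᵖ
      (RestrictedEnvelopingAlgebra p K L)ᵐᵒᵖ (RestrictedEnvelopingAlgebra p K L)ᵐᵒᵖ :=
    ⟨fun r t t' => by
      rw [hsmul, hsmul, smul_eq_mul, smul_eq_mul, unop_mul, mul_assoc, op_mul, op_unop, op_mul]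
      rfl⟩
  let X := trivialRestrictedModule p K L
  let : Module (RestrictedEnvelopingAlgebra p K S)ᵐᵒᵖ X :=
    Module.compHom X (RestrictedEnvelopingAlgebra.map f).toRingHom.op
  have : IsScalarTower (RestrictedEnvelopingAlgebra p K S)ᵐᵒᵖ
      (RestrictedEnvelopingAlgebra p K L)ᵐᵒᵖ X := ⟨fun r t x =>
    mul_smul ((RestrictedEnvelopingAlgebra.map f).toRingHom.op r) t x⟩
  let b := Module.finBasis K S
  have : Finite {w : List (Fin (Module.finrank K S)) // IsRestrictedWord p w} :=
    finite_isRestrictedWord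
  have : FiniteDimensional K (RestrictedEnvelopingAlgebra p K S)ᵐᵒᵖ :=
    Module.Finite.of_basis ((pbwBasis p b).map (opLinearEquiv K))
  have hproj : Module.Projective (RestrictedEnvelopingAlgebra p K S)ᵐᵒᵖ X := by
    refine projective_of_hasProjectiveDimensionLE (T := (RestrictedEnvelopingAlgebra p K L)ᵐᵒᵖ)
      (fun Y P _ _ _ _ _ g hg => ?_) n X hn
    refine exists_leftInverse_of_frobenius
      (topCoeff p b ∘ₗ (opLinearEquiv K).symm.toLinearMap) (fun a ha => ?_) g hg
    obtain ⟨c, hc⟩ := exists_topCoeff_mul_ne_zero b (a := unop a) (by simpa using ha)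
    exact ⟨op c, by simpa using hc⟩
  -- `S` acts on `X = K` through the augmentation of `u(S)`; `e` hides the universe lift.
  let e : K → X := fun c => (ULift.up c : ULift.{max u v} K)
  have hact (r : (RestrictedEnvelopingAlgebra p K S)ᵐᵒᵖ) (c : K) :
      r • e c = e (augmentation p K S (unop r) * c) := by
    rw [← augmentation_map f]
    rfl
  have hone (r : (RestrictedEnvelopingAlgebra p K S)ᵐᵒᵖ) :
      r • e 1 = op (algebraMap K (RestrictedEnvelopingAlgebra p K S)
      (augmentation p K S (unop r))) • e 1 := by
    rw [hact, hact, unop_op, AlgHom.commutes]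
    rfl
  let ε := LinearMap.toSpanSingleton (RestrictedEnvelopingAlgebra p K S)ᵐᵒᵖ X (e 1)
  have hε : LinearMap.range ε = ⊤ := by
    refine LinearMap.range_eq_top.2 fun x => ⟨op (algebraMap K _ (ULift.down.{max u v} x)), ?_⟩
    rw [LinearMap.toSpanSingleton_apply, hact, unop_op, AlgHom.commutes, mul_one]
    rfl
  obtain ⟨s, hs⟩ := Module.projective_lifting_property ε LinearMap.id (LinearMap.range_eq_top.1 hε)
  refine ⟨unop (s (e 1)), ?_, fun a => ?_⟩
  · have h1 : ε (s (e 1)) = e 1 := LinearMap.congr_fun hs (e 1)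
    rw [LinearMap.toSpanSingleton_apply, hact, mul_one] at h1
    exact congrArg ULift.down.{max u v} h1
  · apply op_injective
    have h1 := congrArg s (hone (op a))
    rw [map_smul, map_smul, smul_eq_mul, smul_eq_mul] at h1
    rw [op_mul, op_unop, h1, unop_op, Algebra.smul_def, Algebra.commutes, op_mul, op_unop]

end Integral
end

noncomputable section

/-! ### Central extensions -/

section CentralExtension

open RestrictedEnvelopingAlgebra (ι)

variable {p : ℕ} {K E S : Type*} [Field K] [LieRing E] [LieAlgebra K E] [LiePAlgebra p K E]
  [LieRing S] [LieAlgebra K S] [LiePAlgebra p K S]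

theorem RestrictedEnvelopingAlgebra.commute_ι {z : E} (hz : ∀ x : E, ⁅z, x⁆ = 0)
    (a : RestrictedEnvelopingAlgebra p K E) : Commute (ι p K z) a := by
  have h : (⊤ : Submodule K (RestrictedEnvelopingAlgebra p K E)) ≤
      Submodule.span K (Set.range (monomial p (Module.Basis.ofVectorSpace K E))) :=
    (span_range_monomial _).ge
  induction h (Submodule.mem_top (x := a)) using Submodule.span_induction with
  | mem _ h =>
    obtain ⟨w, rfl⟩ := h
    induction w with
    | nil => exact Commute.one_right _
    | cons i w ih =>
      rw [monomial_cons]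
      refine Commute.mul_right ?_ ih
      have := RestrictedEnvelopingAlgebra.ι_lie p K z (Module.Basis.ofVectorSpace K E i)
      rw [hz, map_zero] at this
      exact (sub_eq_zero.1 this.symm)
  | zero => exact Commute.zero_right _
  | add _ _ _ _ h₁ h₂ => exact h₁.add_right h₂
  | smul c _ _ h => exact h.smul_right c

theorem RestrictedEnvelopingAlgebra.map_surjective (f : LiePHom p K E S)
    (hf : Function.Surjective f.toLieHom) :
    Function.Surjective (RestrictedEnvelopingAlgebra.map f) := by
  rw [← AlgHom.coe_toLinearMap, ← LinearMap.range_eq_top, eq_top_iff,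
    ← span_range_monomial (Module.Basis.ofVectorSpace K S), Submodule.span_le]
  rintro _ ⟨w, rfl⟩
  induction w with
  | nil => exact ⟨1, by simp⟩
  | cons i w ih =>
    obtain ⟨a, ha⟩ := ih
    obtain ⟨x, hx⟩ := hf (Module.Basis.ofVectorSpace K S i)
    rw [AlgHom.toLinearMap_apply] at ha
    exact ⟨ι p K x * a, by simp [hx, ha]⟩

/-- If `S = E / K z` with `z` central, then the kernel of `u(E) → u(S)` is generated by `z`. -/
theorem RestrictedEnvelopingAlgebra.exists_eq_mul_ι_of_map_eq_zero (f : LiePHom p K E S)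
    (hf : Function.Surjective f.toLieHom) {z : E} (hz : ∀ x : E, ⁅z, x⁆ = 0)
    (hker : ∀ x, f.toLieHom x = 0 → ∃ c : K, x = c • z)
    {a : RestrictedEnvelopingAlgebra p K E} (ha : RestrictedEnvelopingAlgebra.map f a = 0) :
    ∃ c, a = c * ι p K z := by
  let Z : Ideal (RestrictedEnvelopingAlgebra p K E) := Ideal.span {ι p K z}
  have hZ : Z.IsTwoSided := ⟨fun {x} y hx => by
    obtain ⟨c, rfl⟩ := Ideal.mem_span_singleton'.1 hx
    rw [mul_assoc, (commute_ι hz y).eq, ← mul_assoc]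
    exact Ideal.mem_span_singleton'.2 ⟨_, rfl⟩⟩
  let q : RestrictedEnvelopingAlgebra p K E →ₐ[K] RestrictedEnvelopingAlgebra p K E ⧸ Z :=
    Ideal.Quotient.mkₐ K Z
  obtain ⟨σ, hσ⟩ := (f.toLieHom : E →ₗ[K] S).exists_rightInverse_of_surjective
    (LinearMap.range_eq_top.2 hf)
  replace hσ : ∀ x, f.toLieHom (σ x) = x := fun x => LinearMap.congr_fun hσ x
  have hq : ∀ x y, f.toLieHom x = f.toLieHom y → q (ι p K x) = q (ι p K y) := fun x y h => by
    obtain ⟨c, hc⟩ := hker (x - y) (by rw [map_sub, h, sub_self])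
    rw [← sub_eq_zero, ← map_sub, ← map_sub, hc, map_smul]
    refine Ideal.Quotient.eq_zero_iff_mem.2 (Ideal.mem_span_singleton'.2 ⟨algebraMap K _ c, ?_⟩)
    rw [Algebra.smul_def]
  let g : RestrictedEnvelopingAlgebra p K S →ₐ[K] RestrictedEnvelopingAlgebra p K E ⧸ Z :=
    RestrictedEnvelopingAlgebra.lift (q.toLinearMap ∘ₗ ι p K ∘ₗ σ)
      (fun x y => by
        have := hq (σ ⁅x, y⁆) ⁅σ x, σ y⁆ (by rw [LieHom.map_lie, hσ, hσ, hσ])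
        simp only [LinearMap.comp_apply, AlgHom.toLinearMap_apply, this,
          RestrictedEnvelopingAlgebra.ι_lie, map_sub, map_mul])
      (fun x => by
        have := hq (σ (LiePAlgebra.pMap p K x)) (LiePAlgebra.pMap p K (σ x))
          (by rw [f.map_pMap', hσ, hσ])
        simp only [LinearMap.comp_apply, AlgHom.toLinearMap_apply, this,
          RestrictedEnvelopingAlgebra.ι_pMap, map_pow])
  have hg : g.comp (RestrictedEnvelopingAlgebra.map f) = q := by
    refine RestrictedEnvelopingAlgebra.algHom_ext' fun x => ?_
    rw [AlgHom.comp_apply, map_ι]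
    exact (RestrictedEnvelopingAlgebra.lift_ι _ _ _ _).trans (hq _ _ (hσ _))
  have h0 : q a = 0 := by rw [← hg, AlgHom.comp_apply, ha, map_zero]
  obtain ⟨c, hc⟩ := Ideal.mem_span_singleton'.1 (Ideal.Quotient.eq_zero_iff_mem.1 h0)
  exact ⟨c, hc.symm⟩

variable [hp : Fact p.Prime]

open RestrictedEnvelopingAlgebra (augmentation)

theorem augmentation_monomial_of_ne_nil {J : Type*} (b : Module.Basis J K E) {w : List J}
    (hw : w ≠ []) : augmentation p K E (monomial p b w) = 0 := by
  cases w with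
  | nil => exact absurd rfl hw
  | cons i w => simp [RestrictedEnvelopingAlgebra.augmentation_ι]

variable [CharP K p]

/-- If `z ≠ 0` is central with `z^[p] = 0`, the coefficient of `z` in a product `a z` is the
constant term of `a`. -/
theorem exists_coeff_mul_ι {z : E} (hz0 : z ≠ 0) (hzp : LiePAlgebra.pMap p K z = 0) :
    ∃ r : RestrictedEnvelopingAlgebra p K E →ₗ[K] K,
      ∀ a, r (a * ι p K z) = augmentation p K E a := by
  obtain ⟨I, b, hb⟩ := exists_basis_sumLex (LinearMap.toSpanSingleton K E z)
    (LinearMap.ker_eq_bot.1 (LinearMap.ker_toSpanSingleton K hz0)) (Module.Basis.singleton Unit K)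
  replace hb : b (toLex (Sum.inr ())) = z := by rw [hb]; simp
  obtain ⟨_, _⟩ := exists_wellFoundedLT I
  have := wellFoundedLT_sumLex I Unit
  have hz1 : IsRestrictedWord p (joinWords ([] : List I) [()]) :=
    isRestrictedWord_joinWords.2 ⟨⟨by simp, by simp [hp.out.pos]⟩, by simp,
      fun _ => by simpa using hp.out.one_lt⟩
  have hmul (v : List I) (u : List Unit) :
      monomial p b (joinWords v u) * ι p K z = monomial p b (joinWords v (u ++ [()])) := by
    simp [joinWords, hb, mul_assoc]
  refine ⟨(pbwBasis p b).coord ⟨_, hz1⟩, fun a => ?_⟩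
  refine LinearMap.congr_fun (f := (pbwBasis p b).coord ⟨_, hz1⟩ ∘ₗ
    LinearMap.mulRight K (ι p K z)) (g := (augmentation p K E).toLinearMap)
    ((pbwBasis p b).ext fun ⟨w, hw⟩ => ?_) a
  obtain ⟨v, u, rfl⟩ := exists_joinWords_eq hw.1
  obtain ⟨hv, hu⟩ := isRestrictedWord_joinWords.1 hw
  rw [LinearMap.comp_apply, LinearMap.mulRight_apply, pbwBasis_apply, hmul,
    AlgHom.toLinearMap_apply]
  by_cases hu' : IsRestrictedWord p (u ++ [()])
  · rw [← pbwBasis_apply b ⟨_, isRestrictedWord_joinWords.2 ⟨hv, hu'⟩⟩, Module.Basis.coord_apply,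
      Module.Basis.repr_self]
    by_cases hvu : v = [] ∧ u = []
    · obtain ⟨rfl, rfl⟩ := hvu
      refine Eq.trans ?_ (map_one (augmentation p K E)).symm
      exact Finsupp.single_eq_same
    · rw [augmentation_monomial_of_ne_nil, Finsupp.single_eq_of_ne]
      · intro h
        have h' := joinWords_injective (congrArg Subtype.val h)
        exact hvu ⟨h'.1.symm, by simpa using h'.2.symm⟩
      · simpa [joinWords, not_and] using hvu
  · -- Here `u` consists of `p - 1` letters `z`, and the product contains `z ^ p = z^[p] = 0`.
    have hrep : u ++ [()] = List.replicate p () := by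
      rw [List.eq_replicate_iff]
      refine ⟨le_antisymm ?_ ?_, fun _ _ => rfl⟩
      · have := hu.2 ()
        rw [List.count_eq_length.2 (fun _ _ => rfl)] at this
        simpa using this
      · by_contra! hlt
        refine hu' ⟨List.pairwise_of_forall (fun _ _ => le_rfl), fun i => ?_⟩
        exact List.count_le_length.trans_lt hlt
    have hzero : monomial p b (joinWords v (u ++ [()])) = 0 := by
      rw [hrep, joinWords, List.map_replicate, monomial_append]
      have : monomial p b (List.replicate p (toLex (Sum.inr ()))) = ι p K z ^ p := by
        simp [monomial, hb]
      rw [this, ← RestrictedEnvelopingAlgebra.ι_pMap, hzp, map_zero, mul_zero]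
    have hne : joinWords v u ≠ [] := by
      rintro h
      have h' := joinWords_injective (h.trans (show [] = joinWords [] [] from rfl))
      have := congrArg List.length hrep
      rw [h'.2] at this
      have := hp.out.one_lt
      simp at *
      omega
    rw [hzero, map_zero, augmentation_monomial_of_ne_nil b hne]

/-- A central extension `E` of `S` by `K z` with `z^[p] = 0` splits once the augmentation of
`u(S)` does. -/
theorem exists_character_of_central (f : LiePHom p K E S) (hf : Function.Surjective f.toLieHom)
    {z : E} (hz : ∀ x : E, ⁅z, x⁆ = 0) (hz0 : z ≠ 0) (hzp : LiePAlgebra.pMap p K z = 0)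
    (hker : ∀ x, f.toLieHom x = 0 → ∃ c : K, x = c • z)
    {θ : RestrictedEnvelopingAlgebra p K S} (hθ1 : augmentation p K S θ = 1)
    (hθ : ∀ a, θ * a = augmentation p K S a • θ) :
    ∃ χ : E →ₗ[K] K, χ z = 1 ∧ (∀ x y : E, χ ⁅x, y⁆ = 0) ∧
      ∀ x, χ (LiePAlgebra.pMap p K x) = 0 := by
  -- The form `a ↦ r (t * a)` vanishes on the square of the augmentation ideal and is `1` at `z`.
  obtain ⟨r, hr⟩ := exists_coeff_mul_ι hz0 hzp
  obtain ⟨t, rfl⟩ := RestrictedEnvelopingAlgebra.map_surjective f hf θ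
  have hmul : ∀ a b, augmentation p K E a = 0 → augmentation p K E b = 0 → r (t * (a * b)) = 0 := by
    intro a b ha hb
    obtain ⟨c, hc⟩ := RestrictedEnvelopingAlgebra.exists_eq_mul_ι_of_map_eq_zero f hf hz hker
      (a := t * a)
      (by rw [map_mul, hθ, RestrictedEnvelopingAlgebra.augmentation_map, ha, zero_smul])
    rw [← mul_assoc, hc, mul_assoc, (RestrictedEnvelopingAlgebra.commute_ι hz b).eq, ← mul_assoc,
      hr, map_mul, hb, mul_zero]
  have hι := RestrictedEnvelopingAlgebra.augmentation_ι (p := p) (K := K) (L := E)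
  refine ⟨r ∘ₗ LinearMap.mulLeft K t ∘ₗ ι p K, ?_, fun x y => ?_, fun x => ?_⟩
  · simp [hr, ← RestrictedEnvelopingAlgebra.augmentation_map f, hθ1]
  · simp [RestrictedEnvelopingAlgebra.ι_lie, mul_sub, hmul _ _ (hι x) (hι y),
      hmul _ _ (hι y) (hι x)]
  · obtain ⟨n, hn⟩ := Nat.exists_eq_add_of_le' hp.out.two_le
    have := hmul (ι p K x) (ι p K x ^ (n + 1)) (hι x) (by rw [map_pow, hι, zero_pow (by simp)])
    simpa [RestrictedEnvelopingAlgebra.ι_pMap, hn, pow_succ' _ (n + 1)] using this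

end CentralExtension
end

noncomputable section

/-! ### Frobenius-semilinear forms and tori -/

theorem jacobsonCoeff_eq_zero_of_lie_eq_zero {L : Type*} [LieRing L] {x y : L} (h : ⁅x, y⁆ = 0)
    (n i : ℕ) : jacobsonCoeff x y (n + 1) i = 0 := by
  induction n generalizing i with
  | zero =>
    have h' : ⁅y, x⁆ = 0 := by rw [← lie_skew, h, neg_zero]
    rcases i with _ | _ | i <;> simp [jacobsonCoeff, h']
  | succ n ih => cases i <;> rw [jacobsonCoeff] <;> simp [ih]

theorem pMap_add_of_lie_eq_zero {p : ℕ} [hp : Fact p.Prime] {K L : Type*} [Field K] [LieRing L]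
    [LieAlgebra K L] [LiePAlgebra p K L] {x y : L} (h : ⁅x, y⁆ = 0) :
    LiePAlgebra.pMap p K (x + y) = LiePAlgebra.pMap p K x + LiePAlgebra.pMap p K y := by
  obtain ⟨n, hn⟩ : ∃ n, p - 1 = n + 1 := ⟨p - 2, by have := hp.out.two_le; omega⟩
  rw [LiePAlgebra.pMap_add, hn]
  simp [jacobsonCoeff_eq_zero_of_lie_eq_zero h]

section FrobeniusExtension

variable {p : ℕ} [hp : Fact p.Prime] {K S : Type*} [Field K] [LieRing S] [LieAlgebra K S]
  [LiePAlgebra p K S]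

theorem ad_pow_prod_apply (x y : S × K) (n : ℕ) :
    (LieAlgebra.ad K (S × K) x ^ (n + 1)) y = ((LieAlgebra.ad K S x.1 ^ (n + 1)) y.1, 0) := by
  induction n with
  | zero => simp [LieRing.of_associative_ring_bracket, mul_comm]
  | succ n ih =>
    rw [pow_succ', Module.End.mul_apply, ih, pow_succ' _ (n + 1), Module.End.mul_apply]
    simp

/-- The Lie `p`-algebra structure `(x, a)^[p] = (x^[p], φ x)` on the Lie algebra `S × K`, for a
Frobenius-semilinear form `φ` on `S`. -/
@[reducible] def frobeniusExtension (φ : S → K) (hadd : ∀ x y, φ (x + y) = φ x + φ y)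
    (hsmul : ∀ (c : K) x, φ (c • x) = c ^ p * φ x) : LiePAlgebra p K (S × K) where
  pMap x := (LiePAlgebra.pMap p K x.1, φ x.1)
  pMap_smul c x := Prod.ext (LiePAlgebra.pMap_smul c x.1) (hsmul c x.1)
  pMap_lie x y := by
    obtain ⟨n, hn⟩ := Nat.exists_eq_add_of_le' hp.out.one_le
    conv_rhs => rw [hn, ad_pow_prod_apply, ← hn, ← LiePAlgebra.pMap_lie]
    simp [LieRing.of_associative_ring_bracket, mul_comm]
  pMap_add x y := by
    have h2 : ∀ i, (jacobsonCoeff x y (p - 1) i).2 = 0 := fun i => by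
      obtain ⟨n, hn⟩ := Nat.exists_eq_add_of_le' hp.out.two_le
      rw [hn]
      refine (map_jacobsonCoeff (LinearMap.snd K S K) (fun _ _ => rfl) x y _ _).trans
        (jacobsonCoeff_eq_zero_of_lie_eq_zero ?_ _ _)
      rw [LieRing.of_associative_ring_bracket, mul_comm, sub_self]
    refine Prod.ext ?_ ?_
    · simp only [Prod.fst_add, Prod.fst_sum, Prod.smul_fst]
      rw [LiePAlgebra.pMap_add]
      exact congrArg _ (Finset.sum_congr rfl fun i _ => congrArg _
        (map_jacobsonCoeff (LinearMap.fst K S K) (fun _ _ => rfl) x y _ _).symm)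
    · simp [hadd, Prod.snd_sum, h2]

open RestrictedEnvelopingAlgebra (augmentation)

variable [CharP K p] {θ : RestrictedEnvelopingAlgebra p K S}

/-- Every Frobenius-semilinear form `φ` on `S` is `x ↦ χ (x^[p])` for a character `χ` of `S`,
because the central extension defined by `-φ` splits. -/
theorem exists_character_pMap_eq (hθ1 : augmentation p K S θ = 1)
    (hθ : ∀ a, θ * a = augmentation p K S a • θ) (φ : S → K)
    (hadd : ∀ x y, φ (x + y) = φ x + φ y) (hsmul : ∀ (c : K) x, φ (c • x) = c ^ p * φ x) :
    ∃ χ : S →ₗ[K] K, (∀ x y : S, χ ⁅x, y⁆ = 0) ∧ ∀ x, χ (LiePAlgebra.pMap p K x) = φ x := by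
  let : LiePAlgebra p K (S × K) := frobeniusExtension (fun x => -φ x)
    (fun x y => by rw [hadd, neg_add]) (fun c x => by rw [hsmul, mul_neg])
  have hpMap : ∀ x : S × K, LiePAlgebra.pMap p K x = (LiePAlgebra.pMap p K x.1, -φ x.1) :=
    fun _ => rfl
  have hφ0 : φ 0 = 0 := by simpa using hadd 0 0
  -- The kernel of `S × K → S` is spanned by the central element `(0, 1)`.
  let f : LiePHom p K (S × K) S := ⟨LieHom.fst K S K, fun _ => rfl⟩
  obtain ⟨χ, h1, h2, h3⟩ := exists_character_of_central f (fun x => ⟨(x, 0), rfl⟩)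
    (z := ((0, 1) : S × K))
    (fun x => by simp [LieRing.of_associative_ring_bracket])
    (fun h => one_ne_zero (congrArg Prod.snd h))
    (by rw [hpMap]; simp [pMap_zero, hφ0])
    (fun x hx => ⟨x.2, Prod.ext (hx.trans (smul_zero x.2).symm) (mul_one x.2).symm⟩) hθ1 hθ
  refine ⟨χ ∘ₗ LinearMap.inl K S K, fun x y => ?_, fun x => ?_⟩
  · have := h2 ((x, 0) : S × K) (y, 0)
    simpa using this
  · have := h3 ((x, 0) : S × K)
    have hsplit : ((LiePAlgebra.pMap p K x, -φ x) : S × K) =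
        (LiePAlgebra.pMap p K x, 0) + (-φ x) • ((0, 1) : S × K) := by simp
    rw [hpMap, hsplit, map_add, map_smul, h1, smul_eq_mul, mul_one, add_neg_eq_zero] at this
    exact this

/-- The linear form `g` yields the Frobenius-semilinear form `x ↦ g x ^ p`. -/
theorem exists_character_pMap_eq_pow (hθ1 : augmentation p K S θ = 1)
    (hθ : ∀ a, θ * a = augmentation p K S a • θ) (g : S →ₗ[K] K) :
    ∃ χ : S →ₗ[K] K, (∀ x y : S, χ ⁅x, y⁆ = 0) ∧ ∀ x, χ (LiePAlgebra.pMap p K x) = g x ^ p :=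
  exists_character_pMap_eq hθ1 hθ (fun x => g x ^ p)
    (fun x y => by rw [map_add, add_pow_char]) (fun c x => by rw [map_smul, smul_eq_mul, mul_pow])

/-- The `p`-map preserves linear independence: if `g_j (y_i) = δ_ij`, then the characters
determined by the forms `g_j ^ p` are dual to the `y_i^[p]`. -/
theorem linearIndependent_pMap (hθ1 : augmentation p K S θ = 1)
    (hθ : ∀ a, θ * a = augmentation p K S a • θ) {ι : Type*} {y : ι → S}
    (hy : LinearIndependent K y) : LinearIndependent K fun i => LiePAlgebra.pMap p K (y i) := by
  classical
  obtain ⟨g, hg⟩ := (Finsupp.linearCombination K y).exists_leftInverse_of_injective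
    (LinearMap.ker_eq_bot.2 hy)
  have hg' : ∀ i, g (y i) = Finsupp.single i 1 := fun i => by
    simpa using LinearMap.congr_fun hg (Finsupp.single i 1)
  choose χ _ hχ using fun j => exists_character_pMap_eq_pow hθ1 hθ (Finsupp.lapply j ∘ₗ g)
  rw [linearIndependent_iff']
  intro s c hc j hj
  have h := congrArg (χ j) hc
  rw [map_sum, map_zero, Finset.sum_eq_single_of_mem j hj fun i _ hij => by
    simp [hχ, hg', Finsupp.single_eq_of_ne hij.symm, hp.out.ne_zero]] at h
  simpa [hχ, hg'] using h

/-- A finite-dimensional Lie `p`-algebra `S` such that the augmentation of `u(S)` splits is a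
torus. -/
theorem isPTorus_of_integral [FiniteDimensional K S] (hθ1 : augmentation p K S θ = 1)
    (hθ : ∀ a, θ * a = augmentation p K S a • θ) : IsPTorus p K S := by
  refine ⟨⟨fun x y => ?_⟩, fun x => ?_⟩
  · classical
    -- There are `dim S` independent characters, so they separate the points of `S`.
    let b := Module.finBasis K S
    choose χ hlie hχ using fun j => exists_character_pMap_eq_pow hθ1 hθ (b.coord j)
    have hsurj : Function.Surjective (LinearMap.pi χ) := by
      rw [← LinearMap.range_eq_top, eq_top_iff, ← (Pi.basisFun K _).span_eq, Submodule.span_le]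
      rintro _ ⟨k, rfl⟩
      refine ⟨LiePAlgebra.pMap p K (b k), funext fun j => ?_⟩
      by_cases hjk : j = k
      · simp [hχ, hjk]
      · simp [hχ, hjk, hp.out.ne_zero]
    have hinj := (LinearMap.injective_iff_surjective_of_finrank_eq_finrank (by simp)).2 hsurj
    exact hinj (by rw [map_zero]; exact funext fun j => hlie j x y)
  · by_contra hx
    have hli : ∀ m, LinearIndependent K fun i : Fin m => pPow p K i x := by
      intro m
      induction m with
      | zero => exact linearIndependent_empty_type
      | succ m ih =>
        have hcons : (fun i : Fin (m + 1) => pPow p K i x) =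
            Fin.cons x fun i : Fin m => LiePAlgebra.pMap p K (pPow p K i x) := by
          refine funext fun i => Fin.cases rfl (fun i => ?_) i
          simp [pPow, Function.iterate_succ_apply']
        rw [hcons, linearIndependent_finCons]
        refine ⟨linearIndependent_pMap hθ1 hθ ih, fun hmem => hx (Submodule.span_mono ?_ hmem)⟩
        rintro _ ⟨i, rfl⟩
        exact ⟨i, by simp [pPow, Function.iterate_succ_apply']⟩
    have := (hli (Module.finrank K S + 1)).fintype_card_le_finrank
    simp at this

end FrobeniusExtension

/-! ### The subalgebra generated by an algebraic element -/

section Algebraic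

variable {p : ℕ} {K L : Type*} [Field K] [LieRing L]
  [LieAlgebra K L] [LiePAlgebra p K L]

theorem pPow_succ (k : ℕ) (x : L) : pPow p K (k + 1) x = LiePAlgebra.pMap p K (pPow p K k x) :=
  Function.iterate_succ_apply' _ _ _

theorem ad_pPow (k : ℕ) (x : L) :
    LieAlgebra.ad K L (pPow p K k x) = LieAlgebra.ad K L x ^ p ^ k := by
  induction k with
  | zero => simp [pPow]
  | succ k ih =>
    rw [pow_succ p, pow_mul, ← ih]
    exact LinearMap.ext fun y => by rw [pPow_succ, LieAlgebra.ad_apply, LiePAlgebra.pMap_lie]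

theorem lie_pPow_pPow [hp : Fact p.Prime] (i j : ℕ) (x : L) : ⁅pPow p K i x, pPow p K j x⁆ = 0 := by
  have key : ∀ (n : ℕ) (y : L), ⁅x, y⁆ = 0 → (LieAlgebra.ad K L x ^ p ^ n) y = 0 := by
    intro n y hy
    obtain ⟨m, hm⟩ := Nat.exists_eq_add_of_le' (Nat.one_le_pow n p hp.out.pos)
    rw [hm, pow_succ, Module.End.mul_apply, LieAlgebra.ad_apply, hy, map_zero]
  rw [← LieAlgebra.ad_apply K, ad_pPow]
  refine key i _ ?_
  rw [← lie_skew, ← LieAlgebra.ad_apply K, ad_pPow, key j x (lie_self x), neg_zero]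

theorem lie_eq_zero_of_mem_span {A : Set L} (hA : ∀ a ∈ A, ∀ b ∈ A, ⁅a, b⁆ = 0) {x y : L}
    (hx : x ∈ Submodule.span K A) (hy : y ∈ Submodule.span K A) : ⁅x, y⁆ = 0 := by
  induction hx, hy using Submodule.span_induction₂ with
  | mem_mem a b ha hb => exact hA a ha b hb
  | zero_left => exact zero_lie _
  | zero_right => exact lie_zero _
  | add_left _ _ _ _ _ _ h₁ h₂ => rw [add_lie, h₁, h₂, add_zero]
  | add_right _ _ _ _ _ _ h₁ h₂ => rw [lie_add, h₁, h₂, add_zero]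
  | smul_left _ _ _ _ _ h => rw [smul_lie, h, smul_zero]
  | smul_right _ _ _ _ _ h => rw [lie_smul, h, smul_zero]

variable (p) in
/-- The `p`-subalgebra spanned by a set of commuting elements whose `p`-th powers lie in the
span. -/
def spanOfCommute [Fact p.Prime] (A : Set L) (hA : ∀ a ∈ A, ∀ b ∈ A, ⁅a, b⁆ = 0)
    (hpA : ∀ a ∈ A, LiePAlgebra.pMap p K a ∈ Submodule.span K A) : LiePSubalgebra p K L where
  toSubmodule := Submodule.span K A
  lie_mem' hx hy := by
    rw [lie_eq_zero_of_mem_span hA hx hy]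
    exact (Submodule.span K A).zero_mem
  pMap_mem' x hx := by
    change x ∈ Submodule.span K A at hx
    change _ ∈ Submodule.span K A
    induction hx using Submodule.span_induction with
    | mem a ha => exact hpA a ha
    | zero => rw [pMap_zero]; exact zero_mem _
    | add x y hx hy h₁ h₂ =>
      rw [pMap_add_of_lie_eq_zero (lie_eq_zero_of_mem_span hA hx hy)]
      exact add_mem h₁ h₂
    | smul c x _ h =>
      rw [LiePAlgebra.pMap_smul]
      exact Submodule.smul_mem _ _ h

theorem exists_pPow_mem_span_of_isPAlgebraic {x : L} (hx : IsPAlgebraic p K x) :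
    ∃ n, pPow p K n x ∈ Submodule.span K ((fun k => pPow p K k x) '' Set.Iio n) := by
  classical
  by_contra! h
  refine hx (linearIndependent_iff'.2 fun s c hc => ?_)
  by_contra! hne
  obtain ⟨i, hi, hci⟩ := hne
  obtain ⟨n, hn, hmax⟩ := (s.filter fun k => c k ≠ 0).exists_max_image id
    ⟨i, Finset.mem_filter.2 ⟨hi, hci⟩⟩
  rw [Finset.mem_filter] at hn
  refine h n ((Submodule.smul_mem_iff _ hn.2).1 ?_)
  rw [← Finset.add_sum_erase s _ hn.1] at hc
  rw [eq_neg_of_add_eq_zero_left hc]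
  refine neg_mem (Submodule.sum_mem _ fun k hk => ?_)
  rw [Finset.mem_erase] at hk
  rcases eq_or_ne (c k) 0 with h0 | h0
  · rw [h0, zero_smul]
    exact zero_mem _
  · exact Submodule.smul_mem _ _ (Submodule.subset_span
      ⟨k, (hmax k (Finset.mem_filter.2 ⟨hk.2, h0⟩)).lt_of_ne hk.1, rfl⟩)

/-- A `p`-algebraic element lies in a finite-dimensional `p`-subalgebra. -/
theorem exists_finiteDimensional_of_isPAlgebraic [Fact p.Prime] {x : L} (hx : IsPAlgebraic p K x) :
    ∃ S : LiePSubalgebra p K L, x ∈ S.toLieSubalgebra ∧ FiniteDimensional K S.toLieSubalgebra := by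
  obtain ⟨n, hn⟩ := exists_pPow_mem_span_of_isPAlgebraic hx
  refine ⟨spanOfCommute p ((fun k => pPow p K k x) '' Set.Iio n) ?_ ?_, ?_, ?_⟩
  · rintro _ ⟨i, -, rfl⟩ _ ⟨j, -, rfl⟩
    exact lie_pPow_pPow i j x
  · rintro _ ⟨i, hi, rfl⟩
    rw [← pPow_succ]
    rcases (Nat.succ_le_of_lt hi).lt_or_eq with h | h
    · exact Submodule.subset_span ⟨i + 1, h, rfl⟩
    · rw [← Nat.succ_eq_add_one, h]
      exact hn
  · rcases n.eq_zero_or_pos with rfl | h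
    · exact hn
    · exact Submodule.subset_span ⟨0, h, rfl⟩
  · exact FiniteDimensional.span_of_finite K ((Set.finite_Iio n).image _)

theorem coe_pPow (S : LiePSubalgebra p K L) (k : ℕ) (x : S.toLieSubalgebra) :
    ((pPow p K k x : S.toLieSubalgebra) : L) = pPow p K k (x : L) := by
  induction k with
  | zero => rfl
  | succ k ih =>
    rw [pPow_succ, pPow_succ, ← ih]
    rfl

theorem IsPSemisimple.coe {S : LiePSubalgebra p K L} {x : S.toLieSubalgebra}
    (hx : IsPSemisimple p K x) : IsPSemisimple p K (x : L) := by
  have h := Submodule.mem_map_of_mem (f := (S.toLieSubalgebra.incl : S.toLieSubalgebra →ₗ[K] L)) hx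
  rw [Submodule.map_span, ← Set.range_comp] at h
  refine Submodule.span_mono ?_ h
  rintro _ ⟨k, rfl⟩
  exact ⟨k, (coe_pPow S (k + 1) x).symm⟩

end Algebraic

section Main

theorem isPTorus_of_restrictedCohomologicalDimension_lt_top {p : ℕ} [Fact p.Prime] {K : Type u}
    [Field K] [CharP K p] {L : Type v} [LieRing L] [LieAlgebra K L] [LiePAlgebra p K L]
    (hL : restrictedCohomologicalDimension p K L < ⊤) (S : LiePSubalgebra p K L)
    [FiniteDimensional K S.toLieSubalgebra] : IsPTorus p K S.toLieSubalgebra := by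
  let f : LiePHom p K S.toLieSubalgebra L := ⟨S.toLieSubalgebra.incl, fun _ => rfl⟩
  obtain ⟨θ, hθ1, hθ⟩ := exists_integral f Subtype.val_injective hL
  exact isPTorus_of_integral hθ1 hθ

end Main

end

theorem mainTheorem5 (p : ℕ) [Fact p.Prime] (K : Type u) [Field K] [CharP K p]
    (L : Type v) [LieRing L] [LieAlgebra K L] [LiePAlgebra p K L]
    (hL : restrictedCohomologicalDimension p K L < ⊤) :
    (∀ S : LiePSubalgebra p K L,
      IsPTorus p K S.toLieSubalgebra ∨ ¬ FiniteDimensional K S.toLieSubalgebra) ∧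
    (∀ x : L, x ≠ 0 → IsPAlgebraic p K x → IsPSemisimple p K x) := by
  refine ⟨fun S => or_iff_not_imp_right.2 fun h => ?_, fun x _ hx => ?_⟩
  · have := not_not.1 h
    exact isPTorus_of_restrictedCohomologicalDimension_lt_top hL S
  · obtain ⟨S, hxS, _⟩ := exists_finiteDimensional_of_isPAlgebraic hx
    exact ((isPTorus_of_restrictedCohomologicalDimension_lt_top hL S).2 ⟨x, hxS⟩).coe
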